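/- **Theorem (Attractor tree formula).** Let $r\ge 0$ and $S=\mathbb N^r\setminus\{0\}$. A (rational) *collection* is a map $F:\bigcup_{n\ge1}S^n\to\mathbb Q$; put $\mathbb 1(\alpha)=1$ for $\alpha\in S^1$ and $0$ otherwise. The *plethysm* is $$(F\circ G)(\alpha)=\sum_{\pi}F(\pi_*\alpha)\prod_{j}G(\alpha|_{\pi^{-1}(j)}),\qquad \alpha\in S^n,$$ over order-preserving surjections $\pi:\{1,\dots,n\}\to\{1,\dots,m\}$, $m\ge 1$, with $(\pi_*\alpha)_j=\sum_{i\in\pi^{-1}(j)}\alpha_i$; $F^{-1}$ denotes the two-sided inverse with respect to $\circ$ and $\mathbb 1$. For a $\mathbb Q$-algebra $\mathcal R$ and $H:S\to\mathcal R$ put $(F*H)(\gamma)=\sum_{n\ge 1,\ \alpha\in S^n,\ \alpha_1+\dots+\alpha_n=\gamma}F(\alpha)\,H(\alpha_1)\cdots H(\alpha_n)$. Let $\langle-,-\rangle$ be a skew-symmetric integral bilinear form on $\mathbb Z^r$, let $\mathcal R=\bigoplus_{\gamma\in\mathbb N^r}\mathcal R_\gamma$ be a graded associative $\mathbb Q$-algebra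 such that $\langle\gamma,\gamma'\rangle=0$ implies $[\mathcal R_\gamma,\mathcal R_{\gamma'}]=0$ for $\gamma,\gamma'\in S$, and let $A:S\to\mathcal R$ with $A(\gamma)\in\mathcal R_\gamma$. A *central charge* is $Z=-\theta+\mathbf i\rho$ with $\theta,\rho\in\mathbb R^r$, $\rho_k>0$; it orders $S$ by the slope $\mu_Z(a)=\sum_k\theta_ka_k/\sum_k\rho_ka_k$, i.e. $a\le_Z b$ iff $\mu_Z(a)\le\mu_Z(b)$ and $a\sim_Z b$ iff $\mu_Z(a)=\mu_Z(b)$; $Z$ is *generic* if $a\sim_Z b$ implies $ma=nb$ for some integers $m,n\ge1$. Let $s_Z(\alpha)=1$ if $\alpha_1>_Z\dots>_Z\alpha_n$ and $0$ otherwise; let $\mathbf{log}_Z(\alpha)=(-1)^{n-1}/n$ if $\alpha_1\sim_Z\dots\sim_Z\alpha_n$ and $0$ otherwise. Let $A_Z:S\to\mathcal R$ be the solution of $A=s_Z*A_Z$ (determined recursively), $\bar A_Z=\mathbf{log}_Z*A_Z$, and $g_Z=\mathbf{log}_Z\circ s_Z^{-1}$. For $\gamma\in S$ let $\bar A_*(\gamma)=\bar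 A_{\theta'}(\gamma)$, where $\theta'\in\mathbb R^r$ is a generic perturbation of $\theta=\langle-,\gamma\rangle$ (generic and sufficiently close to $\theta$, depending on $\gamma$; $\theta'$ is used as the central charge with $\rho=(1,\dots,1)$). Let $g_*$ be the collection with $$g_*(\alpha)=\frac{(-1)^{n-1}}{n_0+1}\ \text{ if }\langle\alpha_{\le k},\alpha_{>k}\rangle\ge0\text{ for all }1\le k<n,\qquad g_*(\alpha)=0\ \text{ otherwise},\qquad\alpha\in S^n,$$ where $\alpha_{\le k}=\alpha_1+\dots+\alpha_k$, $\alpha_{>k}=\alpha_{k+1}+\dots+\alpha_n$ and $n_0$ is the number of $1\le k<n$ with $\langle\alpha_{\le k},\alpha_{>k}\rangle=0$. For plane rooted trees $T$ with leaves $1,\dots,n$ and internal vertices having at least two children, let $V(T)$ be the set of internal vertices and, for $v\in V(T)$, let $\alpha|_{\mathrm{ch}\,v}$ be the tuple of the sums $\alpha_u=\sum_i\alpha_i$ over the leaves $i$ below $u$, for the children $u$ of $v$ in order. Put $(\mathbb T F)(\alpha)=\sum_T\prod_{v\in V(T)}F(\alpha|_{\mathrm{ch}\,v})$ for $F$ vanishing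 on $S^1$. Let $F_Z$ be the collection with $F_Z(\alpha)=1$ for $\alpha\in S^1$ and, for $\alpha\in S^n$, $n\ge2$, $$F_Z(\alpha)=\sum_T(-1)^{|V(T)|-1}\bigl(g_Z(\alpha|_{\mathrm{ch}\,v_0})-g_*(\alpha|_{\mathrm{ch}\,v_0})\bigr)\prod_{v\in V(T)\setminus\{v_0\}}g_*(\alpha|_{\mathrm{ch}\,v}),$$ where $v_0$ is the root of $T$. Then $\bar A_*$ is well defined (for each $\gamma$, generic perturbations exist and $\bar A_{\theta'}(\gamma)$ is the same for all generic $\theta'$ sufficiently close to $\langle-,\gamma\rangle$), the inverse $g_*^{-1}$ exists, and for every central charge $Z$ the inverse $s_Z^{-1}$ exists, $$\bar A_Z=F_Z*\bar A_*,\qquad\text{i.e.}\qquad \bar A_Z(\gamma)=\sum_{\alpha_1+\dots+\alpha_n=\gamma}F_Z(\alpha)\,\bar A_*(\alpha_1)\cdots\bar A_*(\alpha_n)\quad(\gamma\in S),$$ and $$F_Z=\mathbb 1+(g_Z-g_*)\circ\mathbb T(\mathbb 1-g_*)=g_Z\circ g_*^{-1}.$$ -/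

import Mathlib

open Filter Topology

namespace AttractorTree

/-! ### The semigroup `S = ℕ^r \ {0}` and tuples in it -/

/-- The commutative semigroup `S = ℕ^r \ {0}`. -/
abbrev S (r : ℕ) : Type := {γ : Fin r → ℕ // γ ≠ 0}

/-- The image of an element of `ℕ^r` in the lattice `Γ = ℤ^r`. -/
def toLattice {r : ℕ} (γ : Fin r → ℕ) : Fin r → ℤ := fun k => (γ k : ℤ)

/-- The degree `δ · γ` with `δ = (1, …, 1)`. -/
def degree {r : ℕ} (γ : S r) : ℕ := ∑ k, γ.1 k

theorem degree_pos {r : ℕ} (γ : S r) : 0 < degree γ := by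
  rcases Function.ne_iff.mp γ.2 with ⟨k, hk⟩
  exact lt_of_lt_of_le (Nat.pos_of_ne_zero hk)
    (Finset.single_le_sum (f := fun k => γ.1 k) (fun _ _ => Nat.zero_le _) (Finset.mem_univ k))

theorem sum_ne_zero {r n : ℕ} (hn : 0 < n) (α : Fin n → S r) :
    (∑ i, (α i).1) ≠ 0 := by
  intro h
  have h1 := (Finset.sum_eq_zero_iff (s := Finset.univ) (f := fun i => (α i).1)).mp h
  exact (α ⟨0, hn⟩).2 (h1 ⟨0, hn⟩ (Finset.mem_univ _))

/-- The sum `‖α‖ = α₁ + ⋯ + αₙ` of a non-empty tuple, as an element of `S`. -/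
def total {r n : ℕ} (hn : 0 < n) (α : Fin n → S r) : S r :=
  ⟨∑ i, (α i).1, sum_ne_zero hn α⟩

theorem degree_total {r n : ℕ} (hn : 0 < n) (α : Fin n → S r) :
    degree (total hn α) = ∑ i, degree (α i) := by
  simp only [degree, total, Finset.sum_apply]
  exact Finset.sum_comm

/-- All expressions `γ = α₁ + ⋯ + αₙ` with `n ≥ 1` and `αᵢ ∈ S` (ordered). -/
abbrev Decomp {r : ℕ} (γ : S r) : Type :=
  {α : (Σ n : ℕ+, (Fin n → S r)) // total α.1.pos α.2 = γ}

theorem le_degree_of_total {r n : ℕ} (hn : 0 < n) (α : Fin n → S r) :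
    n ≤ degree (total hn α) := by
  rw [degree_total]
  calc n = ∑ _i : Fin n, 1 := by simp
    _ ≤ _ := Finset.sum_le_sum fun i _ => degree_pos (α i)

instance finite_decomp {r : ℕ} (γ : S r) : Finite (Decomp γ) := by
  have hle : ∀ (α : Decomp γ) (i : Fin α.1.1), (α.1.2 i).1 ≤ γ.1 := by
    intro α i
    have h : γ.1 = ∑ i, (α.1.2 i).1 := (congrArg Subtype.val α.2).symm
    rw [h]
    exact Finset.single_le_sum (f := fun i => (α.1.2 i).1) (fun _ _ => zero_le)
      (Finset.mem_univ i)
  have hn : ∀ α : Decomp γ, (α.1.1 : ℕ) ≤ degree γ := by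
    intro α
    have h := le_degree_of_total α.1.1.pos α.1.2
    rwa [α.2] at h
  let f : Decomp γ →
      Σ n : Fin (degree γ + 1), (Fin n → {x : Fin r → ℕ // x ∈ Finset.Iic γ.1}) :=
    fun α => ⟨⟨α.1.1, Nat.lt_succ_of_le (hn α)⟩,
      fun i => ⟨(α.1.2 i).1, Finset.mem_Iic.mpr (hle α i)⟩⟩
  refine Finite.of_injective f ?_
  rintro ⟨⟨⟨n, hn⟩, α⟩, hα⟩ ⟨⟨⟨m, hm⟩, β⟩, hβ⟩ h
  simp only [f, Sigma.mk.injEq, Fin.mk.injEq] at h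
  obtain ⟨h1, h2⟩ := h
  change n = m at h1
  subst h1
  have h3 := eq_of_heq h2
  have : α = β := by
    funext i
    have h4 := congrFun h3 i
    simp only [Subtype.mk.injEq] at h4
    exact Subtype.ext h4
  subst this
  rfl

noncomputable instance fintypeDecomp {r : ℕ} (γ : S r) : Fintype (Decomp γ) :=
  Fintype.ofFinite _

theorem degree_part_lt {r : ℕ} {γ : S r} (α : Decomp γ) (h : 2 ≤ (α.1.1 : ℕ)) (i : Fin α.1.1) :
    degree (α.1.2 i) < degree γ := by
  obtain ⟨⟨n, α⟩, hα⟩ := α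
  dsimp only at *
  rw [← hα, degree_total]
  have : Nontrivial (Fin n) := Fin.nontrivial_iff_two_le.mpr h
  obtain ⟨j, hj⟩ := exists_ne i
  exact Finset.single_lt_sum (f := fun i => degree (α i)) hj (Finset.mem_univ i) (Finset.mem_univ j) (degree_pos (α j))
    (fun _ _ _ => Nat.zero_le _)

/-! ### Collections, plethysm and the action on 1-collections -/

/-- Collections with rational values: maps `S^* = ⋃_{n ≥ 1} S^n → ℚ`. -/
abbrev Col (r : ℕ) : Type := (n : ℕ+) → (Fin n → S r) → ℚ

/-- The identity collection `𝟙`. -/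
def idCol (r : ℕ) : Col r := fun n _ => if (n : ℕ) = 1 then 1 else 0

/-- The tuple `π_* α`, where `π` is the order-preserving surjection that collapses the blocks of
the composition `c`. -/
def blockSum {r n : ℕ} (c : Composition n) (α : Fin n → S r) : Fin c.length → S r :=
  fun j => total (c.one_le_blocksFun j) (fun i => α (c.embedding j i))

/-- Plethysm `F ∘ G`. Order-preserving surjections `π : {1, …, n} → J` are the compositions
of `n`, the fibres of `π` being the blocks. -/
def pleth {r : ℕ} (F G : Col r) : Col r := fun n α =>
  ∑ c : Composition n,
    F ⟨c.length, c.length_pos_of_pos n.pos⟩ (blockSum c α) *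
      ∏ j : Fin c.length, G ⟨c.blocksFun j, c.one_le_blocksFun j⟩ (fun i => α (c.embedding j i))

/-- `G` is a two-sided inverse of `F` with respect to plethysm. -/
def IsPlethInv {r : ℕ} (F G : Col r) : Prop := pleth F G = idCol r ∧ pleth G F = idCol r

open Classical in
/-- The inverse `F⁻¹` of `F` with respect to plethysm (zero if `F` has no inverse). -/
noncomputable def plethInv {r : ℕ} (F : Col r) : Col r :=
  if h : ∃ G, IsPlethInv F G then h.choose else 0

/-- The action `F * H` of a collection on a 1-collection with values in a `ℚ`-algebra:
`(F * H)(γ) = ∑_{α₁ + ⋯ + αₙ = γ} F(α) H(α₁) ⋯ H(αₙ)`, an ordered product. -/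
noncomputable def act {r : ℕ} {R : Type*} [Ring R] [Algebra ℚ R] (F : Col r) (H : S r → R) :
    S r → R := fun γ =>
  ∑ α : Decomp γ, F α.1.1 α.1.2 • (List.ofFn fun i => H (α.1.2 i)).prod

/-! ### Plane trees -/

/-- Plane rooted trees with `n` leaves, numbered `1, …, n` from left to right, all of whose
internal vertices have at least two children. A tree is the unit tree (one leaf, no internal
vertex), or it has a root with an ordered list of at least two subtrees; the numbers of leaves of
the subtrees form a composition of `n`, and the `j`-th subtree has the `j`-th block as its set of
leaves. -/
inductive PlaneTree : ℕ → Type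
  | leaf : PlaneTree 1
  | node {n : ℕ} (c : Composition n) (hc : 2 ≤ c.length)
      (children : (j : Fin c.length) → PlaneTree (c.blocksFun j)) : PlaneTree n

theorem blocksFun_lt {n : ℕ} (c : Composition n) (hc : 2 ≤ c.length) (j : Fin c.length) :
    c.blocksFun j < n := by
  have : Nontrivial (Fin c.length) := Fin.nontrivial_iff_two_le.mpr hc
  obtain ⟨k, hk⟩ := exists_ne j
  calc c.blocksFun j < ∑ i, c.blocksFun i :=
        Finset.single_lt_sum hk (Finset.mem_univ j) (Finset.mem_univ k) (c.one_le_blocksFun k)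
          (fun _ _ _ => Nat.zero_le _)
    _ = n := c.sum_blocksFun

instance finite_planeTree (n : ℕ) : Finite (PlaneTree n) := by
  induction n using Nat.strong_induction_on with
  | _ n ih =>
    have : ∀ c : {c : Composition n // 2 ≤ c.length},
        Finite ((j : Fin c.1.length) → PlaneTree (c.1.blocksFun j)) := by
      intro c
      have := fun j => ih _ (blocksFun_lt c.1 c.2 j)
      infer_instance
    let f : PlaneTree n → Option (Σ c : {c : Composition n // 2 ≤ c.length},
        ((j : Fin c.1.length) → PlaneTree (c.1.blocksFun j))) := fun T =>
      match T with
      | .leaf => none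
      | .node c hc ch => some ⟨⟨c, hc⟩, ch⟩
    refine Finite.of_injective f ?_
    intro T T' h
    cases T with
    | leaf =>
      cases T' with
      | leaf => rfl
      | node c hc ch => simp [f] at h
    | node c hc ch =>
      cases T' with
      | leaf => simp [f] at h
      | node c' hc' ch' =>
        simp only [f, Option.some.injEq, Sigma.mk.injEq, Subtype.mk.injEq] at h
        obtain ⟨h1, h2⟩ := h
        subst h1
        rw [eq_of_heq h2]

noncomputable instance fintypePlaneTree (n : ℕ) : Fintype (PlaneTree n) := Fintype.ofFinite _

/-- The number `|V(T)|` of internal vertices. -/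
def PlaneTree.numVertices : {n : ℕ} → PlaneTree n → ℕ
  | _, .leaf => 0
  | _, .node _ _ ch => 1 + ∑ j, (ch j).numVertices

/-- `F(T)(α) = ∏_{v ∈ V(T)} F(α|_{ch v})`, where `α|_{ch v} = (α_u)_{u ∈ ch v}` and `α_u` is the
sum of the `αᵢ` over the leaves `i` below `u`. -/
def PlaneTree.vertexProd {r : ℕ} (F : Col r) : {n : ℕ} → PlaneTree n → (Fin n → S r) → ℚ
  | _, .leaf, _ => 1
  | _, .node c hc ch, α =>
      F ⟨c.length, lt_of_lt_of_le Nat.zero_lt_two hc⟩ (blockSum c α) *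
        ∏ j, (ch j).vertexProd F (fun i => α (c.embedding j i))

/-- For a tree `T` with root `v₀`, the product
`F₀(α|_{ch v₀}) ∏_{v ∈ V(T) \ {v₀}} F(α|_{ch v})` (zero for the unit tree, which has no root). -/
def PlaneTree.rootedProd {r : ℕ} (F₀ F : Col r) : {n : ℕ} → PlaneTree n → (Fin n → S r) → ℚ
  | _, .leaf, _ => 0
  | _, .node c hc ch, α =>
      F₀ ⟨c.length, lt_of_lt_of_le Nat.zero_lt_two hc⟩ (blockSum c α) *
        ∏ j, (ch j).vertexProd F (fun i => α (c.embedding j i))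

/-- The free construction `𝕋 F` (for `F` vanishing on `S = S^1`, so that only trees whose internal
vertices have at least two children contribute). -/
noncomputable def freeCol {r : ℕ} (F : Col r) : Col r := fun n α =>
  ∑ T : PlaneTree n, T.vertexProd F α

/-! ### Central charges and DT invariants -/

/-- A central charge `Z = -θ + iρ` on `ℤ^r` with `ρ_k > 0` for all `k`. -/
structure CentralCharge (r : ℕ) where
  θ : Fin r → ℝ
  ρ : Fin r → ℝ
  ρ_pos : ∀ k, 0 < ρ k

namespace CentralCharge

variable {r : ℕ}

/-- The slope `μ_Z(a) = (∑ θ_k a_k) / (∑ ρ_k a_k)`. The stability is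
`a ≤_Z b ↔ μ_Z(a) ≤ μ_Z(b)`, equivalently `Arg Z(a) ≤ Arg Z(b)`. -/
noncomputable def slope (Z : CentralCharge r) (a : S r) : ℝ :=
  (∑ k, Z.θ k * (a.1 k : ℝ)) / (∑ k, Z.ρ k * (a.1 k : ℝ))

/-- The central charge with parameter `θ` and `ρ = (1, …, 1)`, defining the stability `≤_θ`. -/
def ofTheta (θ : Fin r → ℝ) : CentralCharge r := ⟨θ, fun _ => 1, fun _ => one_pos⟩

/-- The stability is generic: `a ∼_Z b` implies that `a` and `b` are proportional. -/
def IsGeneric (Z : CentralCharge r) : Prop :=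
  ∀ a b : S r, Z.slope a = Z.slope b → ∃ m n : ℕ, 1 ≤ m ∧ 1 ≤ n ∧ m • a.1 = n • b.1

open Classical in
/-- The Harder-Narasimhan collection `s_Z`: `1` if `α₁ >_Z ⋯ >_Z αₙ`, and `0` otherwise. -/
noncomputable def hn (Z : CentralCharge r) : Col r := fun _ α =>
  if ∀ i j, i < j → Z.slope (α j) < Z.slope (α i) then 1 else 0

open Classical in
/-- The collection `log_Z`: `(-1)^(n-1) / n` if `α₁ ∼_Z ⋯ ∼_Z αₙ`, and `0` otherwise. -/
noncomputable def log (Z : CentralCharge r) : Col r := fun n α =>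
  if ∀ i j, Z.slope (α i) = Z.slope (α j) then (-1) ^ ((n : ℕ) - 1) / ((n : ℕ) : ℚ) else 0

/-- The collection `g_Z = log_Z ∘ s_Z⁻¹`. -/
noncomputable def g (Z : CentralCharge r) : Col r := pleth Z.log (plethInv Z.hn)

/-- The stacky DT invariants `A_Z`, given by the recursion
`A(γ) = ∑_{α₁ + ⋯ + αₙ = γ, α₁ >_Z ⋯ >_Z αₙ} A_Z(α₁) ⋯ A_Z(αₙ)`, solved for the summand
`A_Z(γ)` with `n = 1`. -/
noncomputable def stackyDT {R : Type*} [Ring R] [Algebra ℚ R] (Z : CentralCharge r)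
    (A : S r → R) (γ : S r) : R :=
  A γ - ∑ α : {α : Decomp γ // 2 ≤ (α.1.1 : ℕ)},
    Z.hn α.1.1.1 α.1.1.2 • (List.ofFn fun i => Z.stackyDT A (α.1.1.2 i)).prod
termination_by degree γ
decreasing_by exact degree_part_lt α.1 α.2 i

/-- The basic wall-crossing formula `A = s_Z * A_Z` holds for `A_Z` as defined. -/
theorem eq_act_hn_stackyDT {R : Type*} [Ring R] [Algebra ℚ R] (Z : CentralCharge r)
    (A : S r → R) : A = act Z.hn (Z.stackyDT A) := by
  classical
  funext γ
  have h := CentralCharge.stackyDT.eq_1 Z A γ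
  unfold act
  rw [← Finset.sum_filter_add_sum_filter_not Finset.univ (fun α : Decomp γ => 2 ≤ (α.1.1 : ℕ))]
  rw [eq_sub_iff_add_eq] at h
  rw [← h, add_comm]
  congr 1
  · symm
    apply Finset.sum_subtype
    simp
  · let a0 : Decomp γ := ⟨⟨1, fun _ => γ⟩, by
      apply Subtype.ext; exact Fin.sum_univ_one (fun _ => γ.1)⟩
    have : Finset.univ.filter (fun α : Decomp γ => ¬ 2 ≤ (α.1.1 : ℕ)) = {a0} := by
      ext α
      simp only [Finset.mem_filter, Finset.mem_univ, true_and, Finset.mem_singleton]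
      constructor
      · intro h2
        obtain ⟨⟨n, α⟩, hα⟩ := α
        obtain rfl : n = 1 := PNat.eq (by
          have h3 : ¬ 2 ≤ (n : ℕ) := h2
          have h4 := n.pos
          change (n : ℕ) = 1
          omega)
        have : α = fun _ => γ := by
          funext i
          rw [← hα]
          apply Subtype.ext
          have : i = 0 := Subsingleton.elim (α := Fin 1) _ _
          subst this
          exact (Fin.sum_univ_one (fun i => (α i).1)).symm
        subst this
        rfl
      · rintro rfl
        exact (by decide : ¬ 2 ≤ ((1 : ℕ+) : ℕ))
    rw [this, Finset.sum_singleton]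
    have : Z.hn 1 (fun _ => γ) = 1 := by
      unfold hn; simp
    simp only [a0, this, one_smul]
    symm
    have h5 : (List.ofFn (fun _ : Fin 1 => Z.stackyDT A γ)).prod = Z.stackyDT A γ := by simp
    exact h5

/-- The rational DT invariants `Ā_Z = log_Z * A_Z`. -/
noncomputable def rationalDT {R : Type*} [Ring R] [Algebra ℚ R] (Z : CentralCharge r)
    (A : S r → R) : S r → R := act Z.log (Z.stackyDT A)

end CentralCharge

/-! ### Attractor invariants and the attractor tree collection -/

/-- The self-stability `θ = ⟨-, γ⟩`, as an element of `Hom(ℤ^r, ℝ) = ℝ^r`. -/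
def selfStability {r : ℕ} (B : LinearMap.BilinForm ℤ (Fin r → ℤ)) (γ : S r) : Fin r → ℝ :=
  fun k => (B (Pi.single k 1) (toLattice γ.1) : ℝ)

/-- The generic perturbations of `⟨-, γ⟩`: the filter of neighbourhoods of `⟨-, γ⟩` within the
set of generic stability parameters. -/
def genericPerturbations {r : ℕ} (B : LinearMap.BilinForm ℤ (Fin r → ℤ)) (γ : S r) :
    Filter (Fin r → ℝ) :=
  𝓝[{θ' | (CentralCharge.ofTheta θ').IsGeneric}] (selfStability B γ)

open Classical in
/-- The attractor invariant `Ā_*(γ)`: the common value of `Ā_{θ'}(γ)` for all generic `θ'`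
sufficiently close to `⟨-, γ⟩`. -/
noncomputable def attractorDT {r : ℕ} {R : Type*} [Ring R] [Algebra ℚ R]
    (B : LinearMap.BilinForm ℤ (Fin r → ℤ)) (A : S r → R) (γ : S r) : R :=
  if h : ∃ x : R, ∀ᶠ θ' in genericPerturbations B γ,
      (CentralCharge.ofTheta θ').rationalDT A γ = x
  then h.choose else 0

/-- The number `⟨α_{≤ k}, α_{> k}⟩`. -/
def cutPairing {r n : ℕ} (B : LinearMap.BilinForm ℤ (Fin r → ℤ)) (α : Fin n → S r) (k : ℕ) : ℤ :=
  B (toLattice (∑ i : Fin n with i.val < k, (α i).1)) (toLattice (∑ i : Fin n with k ≤ i.val, (α i).1))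

/-- The attractor collection `g_*`. -/
def attractorCol {r : ℕ} (B : LinearMap.BilinForm ℤ (Fin r → ℤ)) : Col r := fun n α =>
  if ∀ k ∈ Finset.Ico 1 (n : ℕ), 0 ≤ cutPairing B α k then
    (-1) ^ ((n : ℕ) - 1) /
      ((((Finset.Ico 1 (n : ℕ)).filter fun k => cutPairing B α k = 0).card : ℚ) + 1)
  else 0

/-- The attractor tree collection `F_Z`: it is `1` on `S`, and on `S^n` with `n ≥ 2` it is
`∑_T (-1)^(|V(T)| - 1) (g_Z(α|_{ch v₀}) - g_*(α|_{ch v₀})) ∏_{v ≠ v₀} g_*(α|_{ch v})`. -/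
noncomputable def treeCol {r : ℕ} (B : LinearMap.BilinForm ℤ (Fin r → ℤ)) (Z : CentralCharge r) :
    Col r := fun n α =>
  if (n : ℕ) = 1 then 1
  else ∑ T : PlaneTree n,
    (-1) ^ (T.numVertices - 1) * T.rootedProd (Z.g - attractorCol B) (attractorCol B) α

end AttractorTree

open AttractorTree

/-!
Collections act faithfully on the universal word-valued map `S → ℚ⟨S⟩`, so plethysm is associative
and unital, and the recursion for plane trees makes `𝕋(𝟙 - F)` a two-sided inverse of every `F`
with `F = 1` on `S¹`.

The equation `g_Z ∘ s_Z = log_Z` is solved by a path weight: `g_Z(α)` is the signed weight of the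
path `k ↦ excess(α_{≤k})`, where the excess of `a` is a positive multiple of its slope minus the
slope of the total. A sign-reversing involution toggling one cut verifies the equation. Since
`⟨α_{≤k}, α_{>k}⟩ = ⟨α_{≤k}, γ⟩` for `α` of total `γ`, the collection `g_*` is the same path weight,
with the pairing `⟨-, γ⟩` in place of the excess.

For `θ'` near `⟨-, γ⟩`, the excess has the sign of the pairing wherever the latter is non-zero.
Rotating `α` cyclically at a zero of the pairing does not change the product of the `A(αᵢ)`, by the
commutation hypothesis, and averaging the weight of the excess over these rotations gives the weight
of the pairing, by the cycle lemma. Hence `Ā_* = g_* * A`, and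
`Ā_Z = g_Z * A = (g_Z ∘ g_*⁻¹) * (g_* * A) = F_Z * Ā_*`.
-/

namespace AttractorTree

variable {r : ℕ}

/-! ### Decompositions as lists -/

/-- The list `[α₁, …, αₙ]` of a decomposition. Comparing lists avoids equalities between functions
on different types `Fin n`. -/
def Decomp.toList {γ : S r} (a : Decomp γ) : List (S r) := List.ofFn a.1.2

theorem Decomp.toList_injective {γ : S r} : Function.Injective (Decomp.toList (γ := γ)) := by
  rintro ⟨⟨⟨n, hn⟩, α⟩, hα⟩ ⟨⟨⟨m, hm⟩, β⟩, hβ⟩ h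
  cases List.ofFn_inj'.mp h
  rfl

theorem Decomp.sum_toList {γ : S r} (a : Decomp γ) : (a.toList.map Subtype.val).sum = γ.1 := by
  rw [toList, List.map_ofFn, List.sum_ofFn]
  exact congrArg Subtype.val a.2

theorem Decomp.exists_toList_eq {γ : S r} {l : List (S r)}
    (h : (l.map Subtype.val).sum = γ.1) : ∃ a : Decomp γ, a.toList = l := by
  have hl : 0 < l.length := by
    rw [List.length_pos_iff]
    rintro rfl
    exact γ.2 h.symm
  have hsum : ∑ i, (l.get i).1 = γ.1 := by
    conv_rhs => rw [← h, ← List.ofFn_get l, List.map_ofFn, List.sum_ofFn]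
    rfl
  exact ⟨⟨⟨⟨l.length, hl⟩, l.get⟩, Subtype.ext hsum⟩, List.ofFn_get l⟩

/-- The decomposition of `γ` with the single term `γ`. -/
def Decomp.single (γ : S r) : Decomp γ :=
  ⟨⟨1, fun _ => γ⟩, Subtype.ext (Fin.sum_univ_one fun _ => γ.1)⟩

theorem Decomp.eq_single_of_length_eq_one {γ : S r} {a : Decomp γ} (h : (a.1.1 : ℕ) = 1) :
    a = Decomp.single γ := by
  obtain ⟨δ, hδ⟩ := List.length_eq_one_iff.mp ((List.length_ofFn (f := a.1.2)).trans h)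
  have hsum : (a.toList.map Subtype.val).sum = δ.1 := by simp [Decomp.toList, hδ]
  have : δ = γ := Subtype.ext (hsum.symm.trans a.sum_toList)
  exact Decomp.toList_injective (hδ.trans (by rw [this]; rfl))

theorem splitWrtComposition_ofFn {X : Type*} {n : ℕ} (c : Composition n) (x : Fin n → X) :
    (List.ofFn x).splitWrtComposition c =
      List.ofFn fun j => List.ofFn fun i => x (c.embedding j i) := by
  refine List.ext_getElem (by simp) fun j _ hj => ?_
  have hj : j < c.length := by simpa using hj
  have hsucc := c.sizeUpTo_succ hj
  have hle := c.sizeUpTo_le (j + 1)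
  simp only [List.getElem_splitWrtComposition, List.getElem_ofFn]
  refine List.ext_getElem ?_ fun i _ _ => ?_
  · simp only [List.length_drop, List.length_take, List.length_ofFn, Composition.blocksFun,
      List.get_eq_getElem]
    omega
  · simp only [List.getElem_drop, List.getElem_take, List.getElem_ofFn]
    rfl

theorem flatten_ofFn_embedding {X : Type*} {n : ℕ} (c : Composition n) (x : Fin n → X) :
    (List.ofFn fun j => List.ofFn fun i => x (c.embedding j i)).flatten = List.ofFn x := by
  rw [← splitWrtComposition_ofFn]
  exact List.flatten_splitWrtCompositionAux (by simp [c.blocks_sum])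

theorem sum_embedding {M : Type*} [AddCommMonoid M] {n : ℕ} (c : Composition n) (x : Fin n → M) :
    ∑ j, ∑ i, x (c.embedding j i) = ∑ i, x i := by
  rw [← c.blocksFinEquiv.sum_comp, Fintype.sum_sigma]
  rfl

theorem total_blockSum {n : ℕ} (c : Composition n) (hn : 0 < n) (α : Fin n → S r) :
    total (c.length_pos_of_pos hn) (blockSum c α) = total hn α :=
  Subtype.ext (sum_embedding c fun i => (α i).1)

/-! ### The action of collections is a monoid action -/

/-- A decomposition of `γ` together with a decomposition of each of its terms. -/
abbrev NestedDecomp (γ : S r) : Type := Σ β : Decomp γ, ∀ j, Decomp (β.1.2 j)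

/-- The list of lists of a nested decomposition. -/
def NestedDecomp.toList {γ : S r} (q : NestedDecomp γ) : List (List (S r)) :=
  List.ofFn fun j => (q.2 j).toList

theorem NestedDecomp.map_sum_toList {γ : S r} (q : NestedDecomp γ) :
    q.toList.map (fun l => (l.map Subtype.val).sum) = q.1.toList.map Subtype.val := by
  simp only [toList, Decomp.toList, List.map_ofFn]
  exact congrArg List.ofFn (funext fun j => (q.2 j).sum_toList)

theorem NestedDecomp.toList_injective {γ : S r} :
    Function.Injective (NestedDecomp.toList (γ := γ)) := by
  rintro ⟨β, a⟩ ⟨β', a'⟩ h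
  obtain rfl : β = β' := by
    apply Decomp.toList_injective
    apply List.map_injective_iff.mpr Subtype.val_injective
    rw [← map_sum_toList ⟨β, a⟩, ← map_sum_toList ⟨β', a'⟩, h]
  obtain rfl : a = a' :=
    funext fun j => Decomp.toList_injective (congrFun (List.ofFn_injective h) j)
  rfl

/-- Cutting a decomposition of `γ` into consecutive blocks. -/
def splitDecomp {γ : S r} (p : Σ α : Decomp γ, Composition α.1.1) : NestedDecomp γ :=
  ⟨⟨⟨⟨p.2.length, p.2.length_pos_of_pos p.1.1.1.pos⟩, blockSum p.2 p.1.1.2⟩,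
      (total_blockSum p.2 p.1.1.1.pos p.1.1.2).trans p.1.2⟩,
    fun j => ⟨⟨⟨p.2.blocksFun j, p.2.one_le_blocksFun j⟩,
      fun i => p.1.1.2 (p.2.embedding j i)⟩, rfl⟩⟩

theorem flatten_toList_splitDecomp {γ : S r} (p : Σ α : Decomp γ, Composition α.1.1) :
    (splitDecomp p).toList.flatten = p.1.toList :=
  flatten_ofFn_embedding p.2 p.1.1.2

theorem map_length_toList_splitDecomp {γ : S r} (p : Σ α : Decomp γ, Composition α.1.1) :
    (splitDecomp p).toList.map List.length = p.2.blocks := by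
  rw [← p.2.ofFn_blocksFun, NestedDecomp.toList, List.map_ofFn]
  exact congrArg List.ofFn (funext fun _ => List.length_ofFn)

theorem splitDecomp_injective {γ : S r} : Function.Injective (splitDecomp (γ := γ)) := by
  rintro ⟨a, c⟩ ⟨b, d⟩ h
  obtain rfl : a = b := Decomp.toList_injective <| by
    rw [← flatten_toList_splitDecomp ⟨a, c⟩, ← flatten_toList_splitDecomp ⟨b, d⟩, h]
  obtain rfl : c = d := Composition.ext <| by
    rw [← map_length_toList_splitDecomp ⟨a, c⟩, ← map_length_toList_splitDecomp ⟨a, d⟩, h]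
  rfl

theorem splitDecomp_surjective {γ : S r} : Function.Surjective (splitDecomp (γ := γ)) := by
  intro q
  obtain ⟨a, ha⟩ : ∃ a : Decomp γ, a.toList = q.toList.flatten := by
    apply Decomp.exists_toList_eq
    rw [List.map_flatten, List.sum_flatten, List.map_map]
    exact (congrArg List.sum q.map_sum_toList).trans q.1.sum_toList
  have hpos : ∀ {i}, i ∈ q.toList.map List.length → 0 < i := by
    simp [NestedDecomp.toList, Decomp.toList]
  have hsum : (q.toList.map List.length).sum = a.1.1 := by
    rw [← List.length_flatten, ← ha, Decomp.toList, List.length_ofFn]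
  refine ⟨⟨a, ⟨_, hpos, hsum⟩⟩, NestedDecomp.toList_injective (List.eq_iff_flatten_eq.mpr ⟨?_, ?_⟩)⟩
  · rw [flatten_toList_splitDecomp, ha]
  · rw [map_length_toList_splitDecomp]

/-- The ordered product `H(α₁) ⋯ H(αₙ)`. -/
def Decomp.prod {M : Type*} [Monoid M] (H : S r → M) {γ : S r} (a : Decomp γ) : M :=
  (a.toList.map H).prod

theorem prod_splitDecomp {M : Type*} [Monoid M] (H : S r → M) {γ : S r}
    (p : Σ α : Decomp γ, Composition α.1.1) :
    (List.ofFn fun j => ((splitDecomp p).2 j).prod H).prod = p.1.prod H := by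
  rw [Decomp.prod, ← flatten_toList_splitDecomp p, List.map_flatten, List.prod_flatten,
    List.map_map, NestedDecomp.toList, List.map_ofFn]
  rfl

section Action

variable {R : Type*} [Ring R] [Algebra ℚ R]

theorem act_apply (F : Col r) (H : S r → R) (γ : S r) :
    act F H γ = ∑ a : Decomp γ, F a.1.1 a.1.2 • a.prod H := by
  simp only [act, Decomp.prod, Decomp.toList, List.map_ofFn, Function.comp_def]

theorem prod_ofFn_act (G : Col r) (H : S r → R) {n : ℕ} (β : Fin n → S r) :
    (List.ofFn fun j => act G H (β j)).prod =
      ∑ a : ∀ j, Decomp (β j), (∏ j, G (a j).1.1 (a j).1.2) •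
        (List.ofFn fun j => (a j).prod H).prod := by
  classical
  simp only [← MultilinearMap.mkPiAlgebraFin_apply (R := ℚ), act_apply, MultilinearMap.map_sum,
    MultilinearMap.map_smul_univ]

theorem act_pleth (F G : Col r) (H : S r → R) : act (pleth F G) H = act F (act G H) := by
  funext γ
  symm
  calc act F (act G H) γ
      = ∑ q : NestedDecomp γ, (F q.1.1.1 q.1.1.2 * ∏ j, G (q.2 j).1.1 (q.2 j).1.2) •
          (List.ofFn fun j => (q.2 j).prod H).prod := by
        rw [act, Fintype.sum_sigma]
        simp only [prod_ofFn_act, Finset.smul_sum, smul_smul]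
    _ = ∑ p : (Σ α : Decomp γ, Composition α.1.1),
          (F ⟨p.2.length, p.2.length_pos_of_pos p.1.1.1.pos⟩ (blockSum p.2 p.1.1.2) *
            ∏ j, G ⟨p.2.blocksFun j, p.2.one_le_blocksFun j⟩
              (fun i => p.1.1.2 (p.2.embedding j i))) • p.1.prod H :=
        (Fintype.sum_bijective splitDecomp ⟨splitDecomp_injective, splitDecomp_surjective⟩ _ _
          fun p => by rw [← prod_splitDecomp H p]; rfl).symm
    _ = act (pleth F G) H γ := by
        simp only [act_apply, pleth, Finset.sum_smul, Fintype.sum_sigma]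

theorem act_idCol (H : S r → R) : act (idCol r) H = H := by
  funext γ
  rw [act_apply, Finset.sum_eq_single (Decomp.single γ)]
  · simp [idCol, Decomp.single, Decomp.prod, Decomp.toList]
  · intro a _ ha
    rw [idCol, if_neg fun h => ha (Decomp.eq_single_of_length_eq_one h), zero_smul]
  · simp

end Action

/-! ### Plethysm is a monoid structure -/

/-- The universal 1-collection, with values in the algebra of noncommutative polynomials in the
elements of `S`. Collections act faithfully on it, which reduces identities for `∘` to identities
for `*`. -/
noncomputable def wordCol (r : ℕ) (γ : S r) : MonoidAlgebra ℚ (FreeMonoid (S r)) :=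
  MonoidAlgebra.of ℚ _ (FreeMonoid.of γ)

theorem Decomp.prod_wordCol {γ : S r} (a : Decomp γ) :
    a.prod (wordCol r) = MonoidAlgebra.of ℚ _ (FreeMonoid.ofList a.toList) :=
  (FreeMonoid.lift_ofList _ _).symm.trans
    (DFunLike.congr_fun (FreeMonoid.lift_restrict (MonoidAlgebra.of ℚ (FreeMonoid (S r)))) _)

theorem coeff_act_wordCol (F : Col r) {γ : S r} (a : Decomp γ) :
    (act F (wordCol r) γ).coeff (FreeMonoid.ofList a.toList) = F a.1.1 a.1.2 := by
  rw [act_apply, MonoidAlgebra.coeff_sum, Finsupp.finsetSum_apply, Finset.sum_eq_single a]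
  · simp [Decomp.prod_wordCol]
  · intro b _ hba
    have : FreeMonoid.ofList b.toList ≠ FreeMonoid.ofList a.toList :=
      fun h => hba (Decomp.toList_injective (FreeMonoid.ofList.injective h))
    simp [Decomp.prod_wordCol, this]
  · simp

theorem act_wordCol_injective : Function.Injective fun F : Col r => act F (wordCol r) := by
  intro F G h
  funext n α
  let a : Decomp (total n.pos α) := ⟨⟨n, α⟩, rfl⟩
  have := congrArg (fun X => (X (total n.pos α)).coeff (FreeMonoid.ofList a.toList)) h
  simpa only [coeff_act_wordCol] using this

theorem pleth_assoc (F G K : Col r) : pleth (pleth F G) K = pleth F (pleth G K) :=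
  act_wordCol_injective (by simp only [act_pleth])

theorem idCol_pleth (F : Col r) : pleth (idCol r) F = F :=
  act_wordCol_injective (by simp only [act_pleth, act_idCol])

theorem pleth_idCol (F : Col r) : pleth F (idCol r) = F :=
  act_wordCol_injective (by simp only [act_pleth, act_idCol])

theorem sub_pleth (F G K : Col r) : pleth (F - G) K = pleth F K - pleth G K := by
  funext n α
  exact (Finset.sum_congr rfl fun _ _ => sub_mul _ _ _).trans (Finset.sum_sub_distrib _ _)

theorem apply_eq_of_one_eq {F G : Col r} (h : F 1 = G 1) {n : ℕ+} (hn : (n : ℕ) = 1)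
    (α : Fin n → S r) : F n α = G n α := by
  obtain rfl : n = 1 := PNat.eq hn
  exact congrFun h α

/-! ### Plane trees and inverses for plethysm -/

namespace PlaneTree

instance : Unique (PlaneTree 1) where
  default := leaf
  uniq
    | leaf => rfl
    | node c hc _ => absurd c.length_le (by omega)

theorem node_injective {n : ℕ} :
    Function.Injective fun x : (Σ c : {c : Composition n // 2 ≤ c.length},
      ∀ j, PlaneTree (c.1.blocksFun j)) => node x.1.1 x.1.2 x.2 := by
  rintro ⟨⟨c, hc⟩, ch⟩ ⟨⟨c', hc'⟩, ch'⟩ h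
  cases h
  rfl

theorem rootedProd_self (F : Col r) {n : ℕ} (hn : n ≠ 1) (T : PlaneTree n) (α : Fin n → S r) :
    T.rootedProd F F α = T.vertexProd F α := by
  cases T with
  | leaf => exact absurd rfl hn
  | node => rfl

theorem sum_rootedProd (F₀ F : Col r) (n : ℕ) (α : Fin n → S r) :
    ∑ T : PlaneTree n, T.rootedProd F₀ F α =
      ∑ c : {c : Composition n // 2 ≤ c.length},
        F₀ ⟨c.1.length, zero_lt_two.trans_le c.2⟩ (blockSum c.1 α) *
          ∏ j, freeCol F ⟨c.1.blocksFun j, c.1.one_le_blocksFun j⟩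
            (fun i => α (c.1.embedding j i)) := by
  classical
  rw [← Fintype.sum_of_injective _ node_injective _ _ _ fun _ => rfl, Fintype.sum_sigma]
  · refine Finset.sum_congr rfl fun c _ => ?_
    simp only [rootedProd, freeCol]
    rw [Finset.prod_univ_sum, Finset.mul_sum, Fintype.piFinset_univ]
    rfl
  · rintro (_ | ⟨c, hc, ch⟩) hT
    · rfl
    · exact absurd ⟨⟨⟨c, hc⟩, ch⟩, rfl⟩ hT

theorem vertexProd_idCol_sub (F : Col r) {n : ℕ} (T : PlaneTree n) (α : Fin n → S r) :
    T.vertexProd (idCol r - F) α = (-1) ^ T.numVertices * T.vertexProd F α := by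
  induction T with
  | leaf => simp [vertexProd, numVertices]
  | node c hc ch ih =>
    have hroot : (idCol r - F) ⟨c.length, zero_lt_two.trans_le hc⟩ (blockSum c α) =
        -F ⟨c.length, zero_lt_two.trans_le hc⟩ (blockSum c α) :=
      (congrArg (· - F _ _) (if_neg (show c.length ≠ 1 by omega))).trans (zero_sub _)
    simp only [vertexProd, numVertices, ih, hroot, Finset.prod_mul_distrib,
      Finset.prod_pow_eq_pow_sum, pow_add]
    ring

theorem rootedProd_idCol_sub (F₀ F : Col r) {n : ℕ} (T : PlaneTree n) (α : Fin n → S r) :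
    T.rootedProd F₀ (idCol r - F) α = (-1) ^ (T.numVertices - 1) * T.rootedProd F₀ F α := by
  cases T with
  | leaf => simp [rootedProd]
  | node c hc ch =>
    simp only [rootedProd, numVertices, vertexProd_idCol_sub, Finset.prod_mul_distrib,
      Finset.prod_pow_eq_pow_sum, Nat.add_sub_cancel_left]
    ring

end PlaneTree

theorem freeCol_one (F : Col r) : freeCol F 1 = 1 := by
  funext α
  exact Fintype.sum_unique fun T : PlaneTree 1 => T.vertexProd F α

theorem pleth_freeCol {F₀ : Col r} (h₀ : F₀ 1 = 0) (F : Col r) (n : ℕ+) (α : Fin n → S r) :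
    pleth F₀ (freeCol F) n α = ∑ T : PlaneTree n, T.rootedProd F₀ F α := by
  rw [PlaneTree.sum_rootedProd]
  refine (Fintype.sum_of_injective _ Subtype.val_injective _ _ (fun c hc => ?_) fun _ => rfl).symm
  have hpos := c.length_pos_of_pos n.pos
  have hlength : c.length = 1 := by
    by_contra hne
    exact hc ⟨⟨c, by omega⟩, rfl⟩
  have hzero : F₀ ⟨c.length, hpos⟩ (blockSum c α) = 0 :=
    apply_eq_of_one_eq (F := F₀) (G := 0) (n := ⟨c.length, hpos⟩) h₀ hlength _
  rw [hzero, zero_mul]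

theorem freeCol_eq {F : Col r} (hF : F 1 = 0) :
    freeCol F = idCol r + pleth F (freeCol F) := by
  funext n α
  rw [Pi.add_apply, Pi.add_apply, pleth_freeCol hF]
  by_cases hn : n = 1
  · subst hn
    have hsum : ∑ T : PlaneTree 1, T.rootedProd F F α = 0 :=
      Fintype.sum_unique fun T : PlaneTree 1 => T.rootedProd F F α
    exact (congrFun (freeCol_one F) α).trans ((congrArg (1 + ·) hsum).trans (add_zero 1)).symm
  · have hn : (n : ℕ) ≠ 1 := fun h => hn (PNat.eq h)
    simp only [PlaneTree.rootedProd_self F hn, freeCol, idCol, if_neg hn, zero_add]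

theorem pleth_freeCol_idCol_sub {F : Col r} (hF : F 1 = 1) :
    pleth F (freeCol (idCol r - F)) = idCol r := by
  have h : (idCol r - F) 1 = 0 := by
    rw [Pi.sub_apply, hF]
    exact sub_self 1
  have hfree := freeCol_eq h
  rw [sub_pleth, idCol_pleth] at hfree
  rwa [add_sub_left_comm, left_eq_add, sub_eq_zero, eq_comm] at hfree

theorem isPlethInv_freeCol {F : Col r} (hF : F 1 = 1) :
    IsPlethInv F (freeCol (idCol r - F)) := by
  set G := freeCol (idCol r - F)
  have hFG : pleth F G = idCol r := pleth_freeCol_idCol_sub hF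
  have hGK : pleth G (freeCol (idCol r - G)) = idCol r := pleth_freeCol_idCol_sub (freeCol_one _)
  have hK : freeCol (idCol r - G) = F := by
    rw [← idCol_pleth (freeCol (idCol r - G))]
    nth_rw 1 [← hFG]
    rw [pleth_assoc, hGK, pleth_idCol]
  exact ⟨hFG, hK ▸ hGK⟩

theorem isPlethInv_plethInv {F : Col r} (hF : F 1 = 1) : IsPlethInv F (plethInv F) := by
  have h : ∃ G, IsPlethInv F G := ⟨_, isPlethInv_freeCol hF⟩
  rw [plethInv, dif_pos h]
  exact h.choose_spec

theorem IsPlethInv.unique {F G K : Col r} (hG : IsPlethInv F G) (hK : IsPlethInv F K) :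
    G = K := by
  rw [← pleth_idCol G, ← hK.1, ← pleth_assoc, hG.2, idCol_pleth]

theorem plethInv_eq_freeCol {F : Col r} (hF : F 1 = 1) : plethInv F = freeCol (idCol r - F) :=
  (isPlethInv_plethInv hF).unique (isPlethInv_freeCol hF)

/-! ### Cut sets of compositions -/

theorem strictMonoOn_sizeUpTo {n : ℕ} (c : Composition n) :
    StrictMonoOn c.sizeUpTo (Set.Iic c.length) := fun _ _ _ hj hij =>
  (c.sizeUpTo_strict_mono (hij.trans_le hj)).trans_le (c.monotone_sizeUpTo hij)

/-- The interior cut points of a composition of `n`, a subset of `{1, …, n - 1}`. -/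
def cuts {n : ℕ} (c : Composition n) : Finset ℕ := (Finset.Ico 1 c.length).image c.sizeUpTo

theorem injOn_sizeUpTo {n : ℕ} (c : Composition n) :
    Set.InjOn c.sizeUpTo (Finset.Ico 1 c.length) :=
  (strictMonoOn_sizeUpTo c).injOn.mono fun _ hi => (Finset.mem_Ico.mp hi).2.le

theorem cuts_subset {n : ℕ} (c : Composition n) : cuts c ⊆ Finset.Ico 1 n := by
  refine Finset.image_subset_iff.mpr fun i hi => ?_
  obtain ⟨h1, h2⟩ := Finset.mem_Ico.mp hi
  have hpos := strictMonoOn_sizeUpTo c (Nat.zero_le _) h2.le h1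
  have hlt := strictMonoOn_sizeUpTo c h2.le Set.self_mem_Iic h2
  rw [c.sizeUpTo_zero] at hpos
  rw [c.sizeUpTo_length] at hlt
  exact Finset.mem_Ico.mpr ⟨hpos, hlt⟩

theorem map_boundaries {n : ℕ} (c : Composition n) :
    c.boundaries.map Fin.valEmbedding = insert 0 (insert n (cuts c)) := by
  have hrange : Finset.range (c.length + 1) =
      insert 0 (insert c.length (Finset.Ico 1 c.length)) := by
    ext i
    simp only [Finset.mem_range, Finset.mem_insert, Finset.mem_Ico]
    omega
  have hmap : c.boundaries.map Fin.valEmbedding =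
      (Finset.range (c.length + 1)).image c.sizeUpTo := by
    rw [← Nat.Iio_eq_range, ← Fin.map_valEmbedding_univ, Finset.map_eq_image, Finset.map_eq_image,
      Composition.boundaries, Finset.map_eq_image, Finset.image_image, Finset.image_image]
    rfl
  rw [hmap, hrange, Finset.image_insert, Finset.image_insert, c.sizeUpTo_zero, c.sizeUpTo_length,
    cuts]

theorem cuts_injective {n : ℕ} : Function.Injective (cuts (n := n)) := by
  intro c d h
  refine (compositionEquiv n).injective (CompositionAsSet.ext ?_)
  apply Finset.map_injective Fin.valEmbedding
  exact (map_boundaries c).trans (h ▸ (map_boundaries d).symm)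

theorem image_cuts (n : ℕ) :
    (Finset.univ : Finset (Composition n)).image cuts = (Finset.Ico 1 n).powerset := by
  refine Finset.eq_of_subset_of_card_le ?_ (le_of_eq ?_)
  · exact Finset.image_subset_iff.mpr fun c _ => Finset.mem_powerset.mpr (cuts_subset c)
  · rw [Finset.card_image_of_injective _ cuts_injective, Finset.card_univ, composition_card,
      Finset.card_powerset, Nat.card_Ico]

theorem sum_cuts {M : Type*} [AddCommMonoid M] (n : ℕ) (φ : Finset ℕ → M) :
    ∑ c : Composition n, φ (cuts c) = ∑ C ∈ (Finset.Ico 1 n).powerset, φ C := by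
  rw [← image_cuts, Finset.sum_image cuts_injective.injOn]

theorem sizeUpTo_add_lt_sizeUpTo_iff {n : ℕ} (c : Composition n) (j : Fin c.length) {m : ℕ}
    (hm : m < c.blocksFun j) (k : ℕ) : c.sizeUpTo j + m < c.sizeUpTo k ↔ j < k := by
  have hsucc := c.sizeUpTo_succ' j
  refine ⟨fun h => lt_of_not_ge fun hkj => ?_, fun hjk => ?_⟩
  · have := c.monotone_sizeUpTo hkj
    omega
  · have := c.monotone_sizeUpTo (Nat.succ_le_of_lt hjk)
    rw [Nat.succ_eq_add_one] at this
    omega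

theorem mem_Ico_sdiff_cuts {n : ℕ} {c : Composition n} {k : ℕ} :
    k ∈ Finset.Ico 1 n \ cuts c ↔
      ∃ j : Fin c.length, ∃ m, m + 1 < c.blocksFun j ∧ c.sizeUpTo j + (m + 1) = k := by
  rw [Finset.mem_sdiff, Finset.mem_Ico]
  constructor
  · rintro ⟨⟨h1, hkn⟩, hk⟩
    obtain ⟨⟨j, m⟩, hjm⟩ := c.blocksFinEquiv.surjective ⟨k - 1, by omega⟩
    have hjm : c.sizeUpTo j + m = k - 1 := congrArg Fin.val hjm
    have hm : (m : ℕ) + 1 ≠ c.blocksFun j := by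
      intro hm
      have hcut : c.sizeUpTo (j + 1) = k := by
        have := c.sizeUpTo_succ' j
        omega
      have hlt : (j : ℕ) + 1 < c.length := by
        refine lt_of_le_of_ne j.2 fun h => ?_
        rw [h, c.sizeUpTo_length] at hcut
        omega
      exact hk (Finset.mem_image.mpr ⟨j + 1, Finset.mem_Ico.mpr ⟨by omega, hlt⟩, hcut⟩)
    exact ⟨j, m, by omega, by omega⟩
  · rintro ⟨j, m, hm, rfl⟩
    have hsucc := c.sizeUpTo_succ' j
    have hle := c.sizeUpTo_le (j + 1)
    refine ⟨⟨by omega, by omega⟩, fun hcut => ?_⟩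
    obtain ⟨i, -, hi⟩ := Finset.mem_image.mp hcut
    have h1 := sizeUpTo_add_lt_sizeUpTo_iff c j hm i
    have h2 := sizeUpTo_add_lt_sizeUpTo_iff c j (Nat.lt_of_succ_lt hm) i
    omega

theorem forall_strictAnti_embedding_iff {β : Type*} [Preorder β] {n : ℕ} (c : Composition n)
    (σ : ℕ → β) :
    (∀ j, StrictAnti fun i => σ (c.embedding j i)) ↔
      ∀ k ∈ Finset.Ico 1 n \ cuts c, σ k < σ (k - 1) := by
  constructor
  · intro h k hk
    obtain ⟨j, m, hm, rfl⟩ := mem_Ico_sdiff_cuts.mp hk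
    exact h j (a := ⟨m, by omega⟩) (b := ⟨m + 1, hm⟩) (Fin.mk_lt_mk.mpr m.lt_succ_self)
  · intro h j i i' hii'
    have hanti : StrictAntiOn (fun m => σ (c.sizeUpTo j + m)) (Set.Iio (c.blocksFun j)) :=
      strictAntiOn_of_add_one_lt Set.ordConnected_Iio fun m _ _ hm =>
        h _ (mem_Ico_sdiff_cuts.mpr ⟨j, m, hm, rfl⟩)
    exact hanti i.2 i'.2 hii'

/-! ### Sums over cut sets -/

section CutWeight

variable {ι M : Type*} [Zero M] [LinearOrder M]

open Classical in
/-- The weight `(-1)^|C| / (n₀ + 1)` of a finite set `C` on which `v ≥ 0`, where `n₀` is the number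
of zeros of `v` on `C`; it is zero if `v` takes a negative value on `C`. -/
noncomputable def cutWeight (C : Finset ι) (v : ι → M) : ℚ :=
  if ∀ k ∈ C, 0 ≤ v k then (-1) ^ C.card / ((C.filter fun k => v k = 0).card + 1) else 0

theorem cutWeight_of_neg {C : Finset ι} {v : ι → M} {k : ι} (hk : k ∈ C) (hv : v k < 0) :
    cutWeight C v = 0 :=
  if_neg fun h => (h k hk).not_gt hv

theorem cutWeight_of_eq_zero {C : Finset ι} {v : ι → M} (hv : ∀ k ∈ C, v k = 0) :
    cutWeight C v = (-1) ^ C.card / (C.card + 1) := by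
  rw [cutWeight, if_pos fun k hk => (hv k hk).ge, Finset.filter_true_of_mem hv]

theorem cutWeight_image {κ : Type*} [DecidableEq κ] {C : Finset ι} {f : ι → κ}
    (hf : Set.InjOn f C) (v : κ → M) : cutWeight (C.image f) v = cutWeight C fun k => v (f k) := by
  classical
  simp only [cutWeight, Finset.forall_mem_image, Finset.card_image_of_injOn hf,
    Finset.filter_image]
  rw [Finset.card_image_of_injOn (hf.mono (Finset.coe_subset.mpr (Finset.filter_subset _ _)))]

theorem cutWeight_insert [DecidableEq ι] {C : Finset ι} {k : ι} (hk : k ∉ C) {v : ι → M}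
    (hv : 0 < v k) : cutWeight (insert k C) v = -cutWeight C v := by
  classical
  have hC : (∀ j ∈ insert k C, 0 ≤ v j) ↔ ∀ j ∈ C, 0 ≤ v j := by simp [hv.le]
  simp only [cutWeight, hC, Finset.card_insert_of_notMem hk, Finset.filter_insert, hv.ne', if_false]
  split_ifs
  · ring
  · exact neg_zero.symm

/-- The sum of the weights of those subsets `C` of `I` whose complement consists of elements
satisfying `P`. -/
noncomputable def cutSum (I : Finset ι) (P : ι → Prop) (v : ι → M) : ℚ :=
  open Classical in
  ∑ C ∈ I.powerset, cutWeight C v * if ∀ k ∈ I \ C, P k then 1 else 0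

/-- Adding `k` to a cut set and removing it from one is a sign-reversing involution. -/
theorem cutSum_of_pos {I : Finset ι} {P : ι → Prop} {v : ι → M} {k : ι} (hk : k ∈ I) (hP : P k)
    (hv : 0 < v k) : cutSum I P v = 0 := by
  classical
  rw [cutSum, ← Finset.insert_erase hk, Finset.sum_powerset_insert (Finset.notMem_erase _ _),
    ← Finset.sum_add_distrib]
  refine Finset.sum_eq_zero fun C hC => ?_
  have hkC : k ∉ C := fun h => Finset.notMem_erase _ _ (Finset.mem_powerset.mp hC h)
  have hiff : (∀ j ∈ insert k (I.erase k) \ insert k C, P j) ↔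
      ∀ j ∈ insert k (I.erase k) \ C, P j := by
    simp only [Finset.insert_erase hk, Finset.mem_sdiff, Finset.mem_insert, not_or]
    exact ⟨fun h j hj => if hjk : j = k then hjk ▸ hP else h j ⟨hj.1, hjk, hj.2⟩,
      fun h j hj => h j ⟨hj.1, hj.2.2⟩⟩
  rw [cutWeight_insert hkC hv, neg_mul]
  simp only [hiff, add_neg_cancel]

theorem cutSum_of_neg {I : Finset ι} {P : ι → Prop} {v : ι → M} {k : ι} (hk : k ∈ I) (hP : ¬P k)
    (hv : v k < 0) : cutSum I P v = 0 := by
  classical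
  refine Finset.sum_eq_zero fun C _ => ?_
  by_cases hkC : k ∈ C
  · rw [cutWeight_of_neg hkC hv, zero_mul]
  · rw [if_neg fun h => hP (h k (Finset.mem_sdiff.mpr ⟨hk, hkC⟩)), mul_zero]

theorem cutSum_of_eq_zero {I : Finset ι} {P : ι → Prop} {v : ι → M} (hP : ∀ k ∈ I, ¬P k)
    (hv : ∀ k ∈ I, v k = 0) : cutSum I P v = (-1) ^ I.card / (I.card + 1) := by
  classical
  rw [cutSum, Finset.sum_eq_single_of_mem I (Finset.mem_powerset_self I)]
  · simp [cutWeight_of_eq_zero hv]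
  · intro C hC hne
    obtain ⟨k, hkI, hkC⟩ := Finset.exists_of_ssubset ((Finset.mem_powerset.mp hC).ssubset_of_ne hne)
    rw [if_neg fun h => hP k hkI (h k (Finset.mem_sdiff.mpr ⟨hkI, hkC⟩)), mul_zero]

end CutWeight

section Path

variable {M β : Type*} [LinearOrder M] [LinearOrder β] {n : ℕ} {V : ℕ → M} {σ : ℕ → β} {μ : β}

/-- The step of the path leading to its last maximum is non-negative, the next one is negative. -/
theorem exists_descent_of_lt (hV : ∀ k < n, cmp (V k) (V (k + 1)) = cmp μ (σ k)) {m : ℕ}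
    (hmn : m ≤ n) (h0 : V 0 < V m) (hn : V n < V m) :
    ∃ k ∈ Finset.Ico 1 n, V m ≤ V k ∧ σ k < σ (k - 1) := by
  obtain ⟨k, hk, hmax⟩ := (Finset.range (n + 1)).exists_max_image (fun k => toLex (V k, k))
    ⟨0, by simp⟩
  simp only [Finset.mem_range, Nat.lt_succ_iff, Prod.Lex.toLex_le_toLex] at hk hmax
  have hle : ∀ i ≤ n, V i ≤ V k := fun i hi => (hmax i hi).elim le_of_lt fun h => h.1.le
  have hmk := hle m hmn
  have hk0 : k ≠ 0 := by
    rintro rfl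
    exact hmk.not_gt h0
  have hkn : k < n := by
    refine lt_of_le_of_ne hk ?_
    rintro rfl
    exact hmk.not_gt hn
  have hnext : V (k + 1) < V k := (hmax (k + 1) hkn).resolve_right fun h => by omega
  obtain ⟨i, rfl⟩ := Nat.exists_eq_add_one_of_ne_zero hk0
  refine ⟨i + 1, Finset.mem_Ico.mpr ⟨by omega, hkn⟩, hmk, ?_⟩
  have hσ : σ (i + 1) < μ := (lt_iff_lt_of_cmp_eq_cmp (cmp_eq_cmp_symm.mp (hV _ hkn))).mp hnext
  exact hσ.trans_le ((le_iff_le_of_cmp_eq_cmp (hV i (by omega))).mp (hle i (by omega)))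

theorem exists_ascent_of_lt (hV : ∀ k < n, cmp (V k) (V (k + 1)) = cmp μ (σ k)) {m : ℕ}
    (hmn : m ≤ n) (h0 : V m < V 0) (hn : V m < V n) :
    ∃ k ∈ Finset.Ico 1 n, V k ≤ V m ∧ σ (k - 1) < σ k :=
  exists_descent_of_lt (M := Mᵒᵈ) (β := βᵒᵈ) (fun k hk => cmp_eq_cmp_symm.mp (hV k hk)) hmn h0 hn

open Classical in
theorem cutSum_descents [Zero M] (hn : 0 < n)
    (hV : ∀ k < n, cmp (V k) (V (k + 1)) = cmp μ (σ k)) (hV0 : V 0 = 0) (hVn : V n = 0) :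
    cutSum (Finset.Ico 1 n) (fun k => σ k < σ (k - 1)) V =
      if ∀ i < n, ∀ j < n, σ i = σ j then (-1) ^ (n - 1) / (n : ℚ) else 0 := by
  have hnonconst {k : ℕ} (hk : k ∈ Finset.Ico 1 n) (hne : σ k ≠ σ (k - 1)) :
      ¬∀ i < n, ∀ j < n, σ i = σ j := fun h =>
    hne (h k (Finset.mem_Ico.mp hk).2 (k - 1) (by have := Finset.mem_Ico.mp hk; omega))
  by_cases hpos : ∃ m ≤ n, 0 < V m
  · obtain ⟨m, hmn, hm⟩ := hpos
    obtain ⟨k, hk, hmk, hσ⟩ := exists_descent_of_lt hV hmn (hV0.trans_lt hm) (hVn.trans_lt hm)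
    rw [cutSum_of_pos hk hσ (hm.trans_le hmk), if_neg (hnonconst hk hσ.ne)]
  by_cases hneg : ∃ m ≤ n, V m < 0
  · obtain ⟨m, hmn, hm⟩ := hneg
    obtain ⟨k, hk, hkm, hσ⟩ := exists_ascent_of_lt hV hmn (hm.trans_eq hV0.symm)
      (hm.trans_eq hVn.symm)
    rw [cutSum_of_neg hk hσ.not_gt (hkm.trans_lt hm), if_neg (hnonconst hk hσ.ne')]
  push Not at hpos hneg
  have hzero : ∀ k ≤ n, V k = 0 := fun k hk => (hpos k hk).antisymm (hneg k hk)
  have hσ : ∀ k < n, σ k = μ := fun k hk =>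
    ((eq_iff_eq_of_cmp_eq_cmp (hV k hk)).mp (by rw [hzero k hk.le, hzero (k + 1) hk])).symm
  rw [cutSum_of_eq_zero, if_pos fun i hi j hj => (hσ i hi).trans (hσ j hj).symm, Nat.card_Ico,
    ← Nat.cast_succ, Nat.succ_eq_add_one, Nat.sub_add_cancel hn]
  · intro k hk
    obtain ⟨h1, h2⟩ := Finset.mem_Ico.mp hk
    rw [hσ k h2, hσ (k - 1) (by omega)]
    exact lt_irrefl μ
  · exact fun k hk => hzero k (Finset.mem_Ico.mp hk).2.le

end Path

/-! ### Path weights and the collection `g_Z` -/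

/-- The partial sum `α_{≤ k} = α₁ + ⋯ + α_k`. -/
def lowerSum {n : ℕ} (α : Fin n → S r) (k : ℕ) : Fin r → ℕ := ∑ i : Fin n with i.val < k, (α i).1

section LowerSum

variable {n : ℕ} (α : Fin n → S r)

theorem lowerSum_zero : lowerSum α 0 = 0 := by simp [lowerSum]

theorem lowerSum_self : lowerSum α n = ∑ i, (α i).1 := by simp [lowerSum]

theorem lowerSum_succ {k : ℕ} (hk : k < n) :
    lowerSum α (k + 1) = lowerSum α k + (α ⟨k, hk⟩).1 := by
  have hfilter : (Finset.univ.filter fun i : Fin n => i.val < k + 1) =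
      insert ⟨k, hk⟩ (Finset.univ.filter fun i : Fin n => i.val < k) := by
    ext i
    simp only [Finset.mem_filter, Finset.mem_insert, Finset.mem_univ, true_and, Fin.ext_iff]
    omega
  rw [lowerSum, hfilter, Finset.sum_insert (by simp), add_comm, lowerSum]

theorem lowerSum_blockSum (c : Composition n) (k : ℕ) :
    lowerSum (blockSum c α) k = lowerSum α (c.sizeUpTo k) := by
  rw [lowerSum, lowerSum, Finset.sum_filter, Finset.sum_filter, ← sum_embedding c]
  refine Finset.sum_congr rfl fun j _ => ?_
  have hiff (i : Fin (c.blocksFun j)) : (c.embedding j i : ℕ) < c.sizeUpTo k ↔ (j : ℕ) < k :=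
    sizeUpTo_add_lt_sizeUpTo_iff c j i.2 k
  simp only [hiff]
  split_ifs
  · rfl
  · exact Finset.sum_const_zero.symm

end LowerSum

/-- The weight of the path `k ↦ f(α_{≤ k})`, where `f` is an additive form and `0 < k < n`. Both
`g_Z` and `g_*` are of this shape, for forms depending on the total `α₁ + ⋯ + αₙ`. -/
noncomputable def pathWeight {M : Type*} [AddMonoid M] [LinearOrder M] (f : (Fin r → ℕ) →+ M)
    {n : ℕ} (α : Fin n → S r) : ℚ :=
  cutWeight (Finset.Ico 1 n) fun k => f (lowerSum α k)

theorem pathWeight_blockSum {M : Type*} [AddMonoid M] [LinearOrder M] (f : (Fin r → ℕ) →+ M)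
    {n : ℕ} (c : Composition n) (α : Fin n → S r) :
    pathWeight f (blockSum c α) = cutWeight (cuts c) fun k => f (lowerSum α k) := by
  simp only [cuts, cutWeight_image (injOn_sizeUpTo c), pathWeight, lowerSum_blockSum]

theorem pathWeight_of_length_eq_one {M : Type*} [AddMonoid M] [LinearOrder M]
    (f : (Fin r → ℕ) →+ M) (α : Fin 1 → S r) : pathWeight f α = 1 := by
  simp [pathWeight, cutWeight]

namespace CentralCharge

/-- The additive form `a ↦ ∑ θ_k a_k`. -/
def linearForm (θ : Fin r → ℝ) : (Fin r → ℕ) →+ ℝ where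
  toFun a := ∑ k, θ k * (a k : ℝ)
  map_zero' := by simp
  map_add' a b := by simp [mul_add, Finset.sum_add_distrib]

theorem linearForm_pos {ρ : Fin r → ℝ} (hρ : ∀ k, 0 < ρ k) (a : S r) : 0 < linearForm ρ a.1 := by
  obtain ⟨k, hk⟩ := Function.ne_iff.mp a.2
  exact Finset.sum_pos' (fun k _ => mul_nonneg (hρ k).le (Nat.cast_nonneg _))
    ⟨k, Finset.mem_univ k, mul_pos (hρ k) (Nat.cast_pos.mpr (Nat.pos_of_ne_zero hk))⟩

/-- The form `a ↦ ρ(b) θ(a) - θ(b) ρ(a)`, which compares the slope of `a` with that of `b`. -/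
def excess (Z : CentralCharge r) (b : S r) : (Fin r → ℕ) →+ ℝ :=
  (AddMonoidHom.mulLeft (linearForm Z.ρ b.1)).comp (linearForm Z.θ) -
    (AddMonoidHom.mulLeft (linearForm Z.θ b.1)).comp (linearForm Z.ρ)

theorem excess_apply (Z : CentralCharge r) (b : S r) (a : Fin r → ℕ) :
    Z.excess b a =
      linearForm Z.ρ b.1 * linearForm Z.θ a - linearForm Z.θ b.1 * linearForm Z.ρ a := rfl

theorem excess_self (Z : CentralCharge r) (b : S r) : Z.excess b b.1 = 0 := by
  rw [excess_apply, mul_comm, sub_self]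

theorem cmp_excess (Z : CentralCharge r) (b a : S r) :
    cmp 0 (Z.excess b a.1) = cmp (Z.slope b) (Z.slope a) := by
  have hb := linearForm_pos Z.ρ_pos b
  have ha := linearForm_pos Z.ρ_pos a
  have h : Z.excess b a.1 =
      linearForm Z.ρ b.1 * linearForm Z.ρ a.1 * (Z.slope a - Z.slope b) := by
    change _ = _ * (linearForm Z.θ a.1 / linearForm Z.ρ a.1 -
      linearForm Z.θ b.1 / linearForm Z.ρ b.1)
    rw [excess_apply]
    field_simp
  rw [h, ← mul_zero (linearForm Z.ρ b.1 * linearForm Z.ρ a.1), cmp_mul_pos_left (mul_pos hb ha),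
    ← cmp_add_right 0 _ (Z.slope b), zero_add, sub_add_cancel]

theorem hn_one (Z : CentralCharge r) : Z.hn 1 = 1 := by
  funext α
  exact if_pos fun (i j : Fin 1) hij => absurd (Subsingleton.elim i j) hij.ne

open Classical in
theorem prod_hn_embedding (Z : CentralCharge r) {n : ℕ} (α : Fin n → S r) (c : Composition n)
    {σ : ℕ → ℝ} (hσ : ∀ i : Fin n, σ i = Z.slope (α i)) :
    ∏ j, Z.hn ⟨c.blocksFun j, c.one_le_blocksFun j⟩ (fun i => α (c.embedding j i)) =
      if ∀ k ∈ Finset.Ico 1 n \ cuts c, σ k < σ (k - 1) then 1 else 0 := by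
  simp only [hn, ← forall_strictAnti_embedding_iff, StrictAnti, hσ]
  rw [Finset.prod_boole]
  simp only [Finset.mem_univ, true_imp_iff]
  rfl

/-- The collection `α ↦ pathWeight (Z.excess ‖α‖) α`, an explicit form of `g_Z`. -/
noncomputable def excessCol (Z : CentralCharge r) : Col r := fun n α =>
  pathWeight (Z.excess (total n.pos α)) α

theorem pleth_excessCol_hn (Z : CentralCharge r) : pleth Z.excessCol Z.hn = Z.log := by
  classical
  funext n α
  set σ : ℕ → ℝ := fun k => if h : k < n then Z.slope (α ⟨k, h⟩) else 0
  set V : ℕ → ℝ := fun k => Z.excess (total n.pos α) (lowerSum α k)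
  have hσ (i : Fin n) : σ i = Z.slope (α i) := dif_pos i.2
  have hV : ∀ k < (n : ℕ), cmp (V k) (V (k + 1)) = cmp (Z.slope (total n.pos α)) (σ k) := by
    intro k hk
    have hstep : V (k + 1) = V k + Z.excess (total n.pos α) (α ⟨k, hk⟩).1 := by
      simp only [V, lowerSum_succ α hk, map_add]
    rw [hσ ⟨k, hk⟩, ← cmp_excess, hstep]
    simpa only [add_zero] using cmp_add_left (V k) 0 (Z.excess (total n.pos α) (α ⟨k, hk⟩).1)
  have hV0 : V 0 = 0 := by simp only [V, lowerSum_zero, map_zero]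
  have hVn : V n = 0 := by
    simp only [V, lowerSum_self]
    exact Z.excess_self _
  calc pleth Z.excessCol Z.hn n α
      = ∑ c : Composition n, cutWeight (cuts c) V *
          if ∀ k ∈ Finset.Ico 1 (n : ℕ) \ cuts c, σ k < σ (k - 1) then 1 else 0 :=
        Finset.sum_congr rfl fun c _ => by
          rw [prod_hn_embedding Z α c hσ, ← pathWeight_blockSum, ← total_blockSum c]
          rfl
    _ = cutSum (Finset.Ico 1 (n : ℕ)) (fun k => σ k < σ (k - 1)) V := by
        rw [cutSum, ← sum_cuts]
        congr!
    _ = Z.log n α := by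
        rw [cutSum_descents n.pos hV hV0 hVn]
        exact if_congr ⟨fun h i j => by rw [← hσ, ← hσ, h i i.2 j j.2],
          fun h i hi j hj => by rw [hσ ⟨i, hi⟩, hσ ⟨j, hj⟩, h]⟩ rfl rfl

theorem g_eq_excessCol (Z : CentralCharge r) : Z.g = Z.excessCol := by
  rw [g, ← pleth_excessCol_hn, pleth_assoc, (isPlethInv_plethInv Z.hn_one).1, pleth_idCol]

theorem g_one (Z : CentralCharge r) : Z.g 1 = 1 := by
  rw [g_eq_excessCol]
  exact funext fun α => pathWeight_of_length_eq_one _ α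

theorem act_g {R : Type*} [Ring R] [Algebra ℚ R] (Z : CentralCharge r) (A : S r → R) :
    act Z.g A = Z.rationalDT A := by
  conv_lhs => rw [Z.eq_act_hn_stackyDT A]
  rw [← act_pleth, g, pleth_assoc, (isPlethInv_plethInv Z.hn_one).2, pleth_idCol, rationalDT]

end CentralCharge

/-! ### The attractor tree collection -/

section Bilinear

variable (B : LinearMap.BilinForm ℤ (Fin r → ℤ))

theorem toLattice_add (a b : Fin r → ℕ) : toLattice (a + b) = toLattice a + toLattice b :=
  funext fun _ => Nat.cast_add _ _

/-- The form `⟨-, γ⟩` on `ℕ^r`. -/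
def pairing (γ : Fin r → ℕ) : (Fin r → ℕ) →+ ℤ where
  toFun a := B (toLattice a) (toLattice γ)
  map_zero' := LinearMap.BilinForm.zero_left _
  map_add' a b := by rw [toLattice_add, LinearMap.BilinForm.add_left]

theorem attractorCol_one : attractorCol B 1 = 1 := by
  funext α
  simp [attractorCol]

theorem treeCol_eq_add_pleth (Z : CentralCharge r) :
    treeCol B Z = idCol r + pleth (Z.g - attractorCol B) (freeCol (idCol r - attractorCol B)) := by
  have h₀ : (Z.g - attractorCol B) 1 = 0 := by
    rw [Pi.sub_apply, Z.g_one, attractorCol_one]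
    exact sub_self 1
  funext n α
  rw [Pi.add_apply, Pi.add_apply, pleth_freeCol h₀]
  by_cases hn : (n : ℕ) = 1
  · obtain rfl : n = 1 := PNat.eq hn
    have hsum : ∑ T : PlaneTree 1, T.rootedProd (Z.g - attractorCol B) (idCol r - attractorCol B) α
        = 0 := Fintype.sum_unique fun T : PlaneTree 1 => T.rootedProd _ _ α
    exact ((congrArg (1 + ·) hsum).trans (add_zero 1)).symm
  · simp only [treeCol, if_neg hn, PlaneTree.rootedProd_idCol_sub, idCol, zero_add]

theorem treeCol_eq_pleth (Z : CentralCharge r) :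
    treeCol B Z = pleth Z.g (plethInv (attractorCol B)) := by
  rw [treeCol_eq_add_pleth, ← plethInv_eq_freeCol (attractorCol_one B), sub_pleth,
    (isPlethInv_plethInv (attractorCol_one B)).1, add_sub_cancel]

theorem cutPairing_eq {B} (hB : B.IsAlt) {n : ℕ} (hn : 0 < n) (α : Fin n → S r) (k : ℕ) :
    cutPairing B α k = pairing B (total hn α).1 (lowerSum α k) := by
  have hsplit : toLattice (total hn α).1 = toLattice (lowerSum α k) +
      toLattice (∑ i : Fin n with k ≤ i.val, (α i).1) := by
    have h := Finset.sum_filter_add_sum_filter_not Finset.univ (fun i : Fin n => i.val < k)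
      fun i => (α i).1
    simp only [not_lt] at h
    exact (congrArg toLattice h.symm).trans (toLattice_add _ _)
  change _ = B (toLattice (lowerSum α k)) (toLattice (total hn α).1)
  rw [hsplit, LinearMap.BilinForm.add_right, hB.self_eq_zero, zero_add]
  rfl

theorem attractorCol_eq_pathWeight {B} (hB : B.IsAlt) (n : ℕ+) (α : Fin n → S r) :
    attractorCol B n α = pathWeight (pairing B (total n.pos α).1) α := by
  simp only [attractorCol, cutPairing_eq hB n.pos, pathWeight, cutWeight, Nat.card_Ico]

end Bilinear

/-! ### Cyclic rotations -/

/-- The cyclic rotation `(α_{k+1}, …, αₙ, α₁, …, α_k)`, where `k ∈ {0, …, n - 1}`. -/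
def rot {n : ℕ} [NeZero n] (k : Fin n) (α : Fin n → S r) : Fin n → S r := fun i => α (i + k)

section Rotation

variable {n : ℕ}

theorem lowerSum_le (α : Fin n → S r) (k : ℕ) : lowerSum α k ≤ ∑ i, (α i).1 :=
  Finset.sum_le_sum_of_subset (Finset.filter_subset _ _)

variable [NeZero n]

theorem rot_neg_rot (k : Fin n) (α : Fin n → S r) : rot (-k) (rot k α) = α :=
  funext fun i => congrArg α (neg_add_cancel_right i k)

theorem sum_rot (k : Fin n) (α : Fin n → S r) : ∑ i, (rot k α i).1 = ∑ i, (α i).1 :=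
  Equiv.sum_comp (Equiv.addRight k) fun i => (α i).1

theorem ofFn_rot (k : Fin n) (α : Fin n → S r) : List.ofFn (rot k α) = (List.ofFn α).rotate k := by
  refine List.ext_getElem (by simp) fun i _ _ => ?_
  simp only [List.getElem_ofFn, List.getElem_rotate, List.length_ofFn]
  rfl

section ZeroCuts

variable {M : Type*} [AddCommGroup M] {f : (Fin r → ℕ) →+ M} {α : Fin n → S r}

open scoped Fin.NatCast in
theorem map_lowerSum_add_one (hf : f (∑ i, (α i).1) = 0) (j : Fin n) :
    f (lowerSum α (j + 1 : Fin n)) = f (lowerSum α j) + f (α j).1 := by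
  rw [← map_add, ← lowerSum_succ α j.2, Fin.val_add, Fin.val_one', Nat.add_mod_mod]
  rcases (Nat.succ_le_of_lt j.2).lt_or_eq with hlt | heq
  · rw [Nat.mod_eq_of_lt hlt]
  · rw [← Nat.succ_eq_add_one, heq, Nat.mod_self, lowerSum_zero, lowerSum_self, hf, map_zero]

open scoped Fin.NatCast in
theorem map_lowerSum_rot (hf : f (∑ i, (α i).1) = 0) (k j : Fin n) :
    f (lowerSum (rot k α) j) = f (lowerSum α (j + k : Fin n)) - f (lowerSum α k) := by
  rw [← Fin.cast_val_eq_self j]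
  generalize (j : ℕ) = m
  induction m with
  | zero => simp [lowerSum_zero]
  | succ m ih =>
    have hrot : f (∑ i, (rot k α i).1) = 0 := by rw [sum_rot, hf]
    rw [Nat.cast_succ, map_lowerSum_add_one hrot, ih, add_right_comm, map_lowerSum_add_one hf,
      sub_add_eq_add_sub]
    rfl

open Classical in
/-- The cuts `0 ≤ k < n` at which the closed path `k ↦ f(α_{≤ k})` is at height zero, including
the trivial cut `k = 0`. -/
noncomputable def zeroCuts (f : (Fin r → ℕ) →+ M) (α : Fin n → S r) : Finset (Fin n) :=
  {j | f (lowerSum α j) = 0}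

omit [NeZero n] in
theorem mem_zeroCuts {j : Fin n} : j ∈ zeroCuts f α ↔ f (lowerSum α j) = 0 := by
  simp [zeroCuts]

theorem zero_mem_zeroCuts : 0 ∈ zeroCuts f α := by
  rw [mem_zeroCuts, Fin.val_zero, lowerSum_zero, map_zero]

theorem mem_zeroCuts_rot (hf : f (∑ i, (α i).1) = 0) {k : Fin n} (hk : k ∈ zeroCuts f α)
    {j : Fin n} : j ∈ zeroCuts f (rot k α) ↔ j + k ∈ zeroCuts f α := by
  rw [mem_zeroCuts, map_lowerSum_rot hf, mem_zeroCuts.mp hk, sub_zero, mem_zeroCuts]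

theorem card_zeroCuts_rot (hf : f (∑ i, (α i).1) = 0) {k : Fin n} (hk : k ∈ zeroCuts f α) :
    (zeroCuts f (rot k α)).card = (zeroCuts f α).card :=
  Finset.card_equiv (Equiv.addRight k) fun _ => mem_zeroCuts_rot hf hk

open Classical in
theorem pathWeight_eq_ite [LinearOrder M] (f : (Fin r → ℕ) →+ M) (α : Fin n → S r) :
    pathWeight f α = if ∀ j : Fin n, 0 ≤ f (lowerSum α j) then
      (-1) ^ (n - 1) / ((zeroCuts f α).card : ℚ) else 0 := by
  have huniv : (Finset.univ : Finset (Fin n)).map Fin.valEmbedding =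
      insert 0 (Finset.Ico 1 n) := by
    rw [Fin.map_valEmbedding_univ, Nat.Iio_eq_range, Finset.range_eq_Ico,
      ← Finset.insert_Ico_add_one_left_eq_Ico (Nat.pos_of_neZero n), zero_add]
  have hzero : f (lowerSum α 0) = 0 := by rw [lowerSum_zero, map_zero]
  have hnonneg : (∀ j : Fin n, 0 ≤ f (lowerSum α j)) ↔
      ∀ k ∈ Finset.Ico 1 n, 0 ≤ f (lowerSum α k) := by
    have := Finset.forall_mem_map (f := Fin.valEmbedding) (s := (Finset.univ : Finset (Fin n)))
      (p := fun k _ => 0 ≤ f (lowerSum α k))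
    rw [huniv] at this
    simpa [hzero, eq_comm] using this.symm
  have hcard : (zeroCuts f α).card =
      ((Finset.Ico 1 n).filter fun k => f (lowerSum α k) = 0).card + 1 := by
    rw [← Finset.card_insert_of_notMem (a := 0) (by simp), ← Finset.card_map Fin.valEmbedding]
    congr 1
    have hinsert := (Finset.filter_insert (fun k => f (lowerSum α k) = 0) 0 (Finset.Ico 1 n)).trans
      (if_pos hzero)
    rw [← hinsert, ← huniv, Finset.filter_map, zeroCuts]
    congr!
  rw [pathWeight, cutWeight, Nat.card_Ico, hcard, Nat.cast_succ]
  exact if_congr hnonneg.symm rfl rfl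

/-- The cycle lemma: a cyclic rotation of a closed path stays non-negative if and only if it starts
at a minimum. -/
theorem sum_pathWeight_rot [LinearOrder M] [IsOrderedAddMonoid M] (hf : f (∑ i, (α i).1) = 0)
    {K : Finset (Fin n)}
    (hK : ∀ k : Fin n, (∀ j : Fin n, f (lowerSum α k) ≤ f (lowerSum α j)) → k ∈ K) :
    ∑ k ∈ K, pathWeight f (rot k α) = (-1) ^ (n - 1) := by
  classical
  set v : Fin n → M := fun j => f (lowerSum α j)
  set minima : Finset (Fin n) := {k | ∀ j, v k ≤ v j}
  have mem_minima {k} : k ∈ minima ↔ ∀ j, v k ≤ v j := by simp [minima]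
  have hnonneg (k : Fin n) : (∀ j : Fin n, 0 ≤ f (lowerSum (rot k α) j)) ↔ k ∈ minima := by
    simp only [map_lowerSum_rot hf, sub_nonneg, mem_minima]
    exact (Equiv.addRight k).surjective.forall (p := fun j => v k ≤ v j) |>.symm
  have hcard {k : Fin n} (hk : k ∈ minima) : (zeroCuts f (rot k α)).card = minima.card := by
    refine Finset.card_equiv (Equiv.addRight k) fun j => ?_
    rw [mem_zeroCuts, map_lowerSum_rot hf, sub_eq_zero, Equiv.coe_addRight, mem_minima]
    exact ⟨fun h i => h.trans_le (mem_minima.mp hk i),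
      fun h => (h k).antisymm (mem_minima.mp hk _)⟩
  have hweight {k : Fin n} (hk : k ∈ minima) :
      pathWeight f (rot k α) = (-1) ^ (n - 1) / minima.card := by
    rw [pathWeight_eq_ite, if_pos ((hnonneg k).mpr hk), hcard hk]
  have hne : minima.Nonempty :=
    (Finite.exists_min v).imp fun _ => mem_minima.mpr
  rw [← Finset.sum_subset (fun k hk => hK k (mem_minima.mp hk)) fun k _ hk => ?_,
    Finset.sum_congr rfl fun _ => hweight, Finset.sum_const, nsmul_eq_mul, mul_div_cancel₀]
  · exact Nat.cast_ne_zero.mpr hne.card_pos.ne'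
  · rw [pathWeight_eq_ite, if_neg ((hnonneg k).not.mpr hk)]

end ZeroCuts

/-- The form `f'` is positive where `f` is, and negative where `f` is, among the summands of `γ`. -/
def RefinesSign {M M' : Type*} [AddCommGroup M] [LinearOrder M] [AddCommGroup M'] [LinearOrder M']
    (f' : (Fin r → ℕ) →+ M') (f : (Fin r → ℕ) →+ M) (γ : Fin r → ℕ) : Prop :=
  ∀ a ≤ γ, (0 < f a → 0 < f' a) ∧ (f a < 0 → f' a < 0)

variable {M M' : Type*} [AddCommGroup M] [LinearOrder M] [AddCommGroup M'] [LinearOrder M']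
  [IsOrderedAddMonoid M'] {f : (Fin r → ℕ) →+ M} {f' : (Fin r → ℕ) →+ M'}

theorem card_zeroCuts_mul_pathWeight {α : Fin n → S r} (hf : f (∑ i, (α i).1) = 0)
    (hf' : f' (∑ i, (α i).1) = 0) (h : RefinesSign f' f (∑ i, (α i).1)) :
    (zeroCuts f α).card * pathWeight f α = ∑ k ∈ zeroCuts f α, pathWeight f' (rot k α) := by
  classical
  by_cases hα : ∀ j : Fin n, 0 ≤ f (lowerSum α j)
  · have hcard : ((zeroCuts f α).card : ℚ) ≠ 0 :=
      Nat.cast_ne_zero.mpr (Finset.card_pos.mpr ⟨0, zero_mem_zeroCuts⟩).ne'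
    rw [pathWeight_eq_ite, if_pos hα, mul_div_cancel₀ _ hcard, sum_pathWeight_rot hf']
    intro k hk
    have hk0 := hk 0
    rw [Fin.val_zero, lowerSum_zero, map_zero] at hk0
    have hnot : ¬0 < f (lowerSum α k) := fun hpos =>
      hk0.not_gt ((h _ (lowerSum_le α k)).1 hpos)
    exact mem_zeroCuts.mpr ((not_lt.mp hnot).antisymm (hα k))
  · obtain ⟨j, hj⟩ := not_forall.mp hα
    rw [pathWeight_eq_ite, if_neg hα, mul_zero]
    refine (Finset.sum_eq_zero fun k hk => ?_).symm
    rw [pathWeight_eq_ite, if_neg]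
    intro hnonneg
    have hneg : f (lowerSum (rot k α) (j - k : Fin n)) < 0 := by
      rwa [map_lowerSum_rot hf, sub_add_cancel, mem_zeroCuts.mp hk, sub_zero, ← not_le]
    exact (hnonneg (j - k)).not_gt ((h _ (sum_rot k α ▸ lowerSum_le _ _)).2 hneg)

end Rotation

theorem Decomp.sum_eq {γ : S r} (a : Decomp γ) : ∑ i, (a.1.2 i).1 = γ.1 :=
  congrArg Subtype.val a.2

/-- The cyclic rotation of a decomposition. -/
def Decomp.rot {γ : S r} (a : Decomp γ) (k : Fin a.1.1) : Decomp γ :=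
  ⟨⟨a.1.1, AttractorTree.rot k a.1.2⟩, Subtype.ext ((sum_rot k a.1.2).trans a.sum_eq)⟩

theorem Decomp.rot_rot_neg {γ : S r} (a : Decomp γ) (k : Fin a.1.1) :
    (⟨(a.rot k).rot (-k), - -k⟩ : Σ a : Decomp γ, Fin a.1.1) = ⟨a, k⟩ := by
  obtain ⟨⟨n, α⟩, hα⟩ := a
  have hcongr : ∀ (β : Fin n → S r) (hβ : total n.pos β = γ) (l : Fin n), β = α → l = k →
      (⟨⟨⟨n, β⟩, hβ⟩, l⟩ : Σ a : Decomp γ, Fin a.1.1) = ⟨⟨⟨n, α⟩, hα⟩, k⟩ := by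
    rintro β hβ l rfl rfl
    rfl
  exact hcongr _ _ _ (rot_neg_rot k α) (neg_neg k)

section Averaging

variable {R M : Type*} [AddCommGroup R] [AddCommGroup M] {f : (Fin r → ℕ) →+ M} {γ : S r}

theorem sum_sum_zeroCuts_rot (hf : f γ.1 = 0) (F : Decomp γ → R) :
    ∑ a : Decomp γ, ∑ k ∈ zeroCuts f a.1.2, F (a.rot k) =
      ∑ a : Decomp γ, (zeroCuts f a.1.2).card • F a := by
  simp only [← Finset.sum_const]
  rw [Finset.sum_sigma', Finset.sum_sigma']
  have hmem {p : Σ a : Decomp γ, Fin a.1.1}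
      (hp : p ∈ Finset.univ.sigma fun a : Decomp γ => zeroCuts f a.1.2) :
      (⟨p.1.rot p.2, -p.2⟩ : Σ a : Decomp γ, Fin a.1.1) ∈
        Finset.univ.sigma fun a : Decomp γ => zeroCuts f a.1.2 := by
    refine Finset.mem_sigma.mpr ⟨Finset.mem_univ _, ?_⟩
    refine (mem_zeroCuts_rot (p.1.sum_eq ▸ hf) (Finset.mem_sigma.mp hp).2).mpr ?_
    rw [neg_add_cancel]
    exact zero_mem_zeroCuts
  exact Finset.sum_nbij' (fun p => ⟨p.1.rot p.2, -p.2⟩) (fun p => ⟨p.1.rot p.2, -p.2⟩)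
    (fun _ => hmem) (fun _ => hmem) (fun p _ => p.1.rot_rot_neg p.2)
    (fun p _ => p.1.rot_rot_neg p.2) fun _ _ => rfl

theorem sum_pathWeight_smul_eq [Module ℚ R] [LinearOrder M] {M' : Type*} [AddCommGroup M']
    [LinearOrder M'] [IsOrderedAddMonoid M'] {f' : (Fin r → ℕ) →+ M'} (hf : f γ.1 = 0)
    (hf' : f' γ.1 = 0) (h : RefinesSign f' f γ.1) {W : Decomp γ → R}
    (hW : ∀ a : Decomp γ, ∀ k ∈ zeroCuts f a.1.2, W (a.rot k) = W a) :
    ∑ a : Decomp γ, pathWeight f a.1.2 • W a = ∑ a : Decomp γ, pathWeight f' a.1.2 • W a := by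
  have hcard (a : Decomp γ) : ((zeroCuts f a.1.2).card : ℚ) ≠ 0 :=
    Nat.cast_ne_zero.mpr (Finset.card_pos.mpr ⟨0, zero_mem_zeroCuts⟩).ne'
  set F : Decomp γ → R := fun a => (pathWeight f' a.1.2 / (zeroCuts f a.1.2).card) • W a
  have haverage (a : Decomp γ) :
      pathWeight f a.1.2 • W a = ∑ k ∈ zeroCuts f a.1.2, F (a.rot k) := by
    have hfa : f (∑ i, (a.1.2 i).1) = 0 := by rw [a.sum_eq, hf]
    rw [← mul_div_cancel_left₀ (pathWeight f a.1.2) (hcard a),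
      card_zeroCuts_mul_pathWeight hfa (by rw [a.sum_eq, hf']) (a.sum_eq ▸ h), Finset.sum_div,
      Finset.sum_smul]
    refine Finset.sum_congr rfl fun k hk => ?_
    rw [← card_zeroCuts_rot hfa hk, ← hW a k hk]
    rfl
  simp only [haverage, sum_sum_zeroCuts_rot hf]
  refine Finset.sum_congr rfl fun a _ => ?_
  rw [← Nat.cast_smul_eq_nsmul ℚ, smul_smul, mul_div_cancel₀ _ (hcard a)]

end Averaging

section Commutation

variable {R : Type*} [Monoid R]

theorem sum_map_val_ne_zero {l : List (S r)} (hl : l ≠ []) : (l.map Subtype.val).sum ≠ 0 := by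
  obtain ⟨a, t, rfl⟩ := List.exists_cons_of_ne_nil hl
  exact fun h => a.2 (add_eq_zero.mp h).1

variable {B : LinearMap.BilinForm ℤ (Fin r → ℤ)} {σ : Type*} [SetLike σ R] {𝒜 : (Fin r → ℕ) → σ}
  [SetLike.GradedMonoid 𝒜] {A : S r → R}

theorem prod_map_append_comm
    (hcomm : ∀ γ γ' : S r, B (toLattice γ.1) (toLattice γ'.1) = 0 →
      ∀ x ∈ 𝒜 γ.1, ∀ y ∈ 𝒜 γ'.1, x * y = y * x)
    (hA : ∀ γ, A γ ∈ 𝒜 γ.1) {l l' : List (S r)}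
    (h : B (toLattice (l.map Subtype.val).sum) (toLattice (l'.map Subtype.val).sum) = 0) :
    ((l ++ l').map A).prod = ((l' ++ l).map A).prod := by
  rcases eq_or_ne l [] with rfl | hl
  · rw [List.nil_append, List.append_nil]
  rcases eq_or_ne l' [] with rfl | hl'
  · rw [List.nil_append, List.append_nil]
  rw [List.map_append, List.map_append, List.prod_append, List.prod_append]
  exact hcomm ⟨_, sum_map_val_ne_zero hl⟩ ⟨_, sum_map_val_ne_zero hl'⟩ h
    _ (SetLike.list_prod_map_mem_graded l _ _ fun a _ => hA a)
    _ (SetLike.list_prod_map_mem_graded l' _ _ fun a _ => hA a)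

theorem Decomp.prod_rot (hB : B.IsAlt)
    (hcomm : ∀ γ γ' : S r, B (toLattice γ.1) (toLattice γ'.1) = 0 →
      ∀ x ∈ 𝒜 γ.1, ∀ y ∈ 𝒜 γ'.1, x * y = y * x)
    (hA : ∀ γ, A γ ∈ 𝒜 γ.1) {γ : S r} (a : Decomp γ) {k : Fin a.1.1}
    (hk : k ∈ zeroCuts (pairing B γ.1) a.1.2) : (a.rot k).prod A = a.prod A := by
  have hrotate : (a.rot k).toList = a.toList.drop k ++ a.toList.take k :=
    (ofFn_rot k a.1.2).trans (List.rotate_eq_drop_append_take (by simp))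
  have hsum : ((a.toList.take k).map Subtype.val).sum = lowerSum a.1.2 k := by
    rw [toList, List.map_take, List.map_ofFn, List.sum_take_ofFn]
    rfl
  have hsplit : γ.1 = ((a.toList.take k).map Subtype.val).sum +
      ((a.toList.drop k).map Subtype.val).sum := by
    rw [← List.sum_append, ← List.map_append, List.take_append_drop, a.sum_toList]
  have hcut : B (toLattice ((a.toList.take k).map Subtype.val).sum) (toLattice γ.1) = 0 := by
    rw [hsum]
    exact mem_zeroCuts.mp hk
  rw [hsplit, toLattice_add, LinearMap.BilinForm.add_right, hB.self_eq_zero, zero_add] at hcut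
  rw [Decomp.prod, Decomp.prod, hrotate, ← prod_map_append_comm hcomm hA hcut,
    List.take_append_drop]

end Commutation

/-! ### Generic perturbations of the self-stability -/

theorem linearForm_selfStability (B : LinearMap.BilinForm ℤ (Fin r → ℤ)) (γ : S r)
    (a : Fin r → ℕ) :
    CentralCharge.linearForm (selfStability B γ) a = pairing B γ.1 a := by
  have hbasis : toLattice a = ∑ k, (a k : ℤ) • Pi.single k (1 : ℤ) := by
    funext i
    simp [toLattice, Pi.single_apply, Finset.sum_apply]
  change ∑ k, selfStability B γ k * (a k : ℝ) = (B (toLattice a) (toLattice γ.1) : ℝ)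
  rw [hbasis, map_sum, LinearMap.sum_apply, Int.cast_sum]
  refine Finset.sum_congr rfl fun k _ => ?_
  rw [map_smul, LinearMap.smul_apply, smul_eq_mul, Int.cast_mul, Int.cast_natCast, mul_comm]
  rfl

theorem excess_selfStability {B : LinearMap.BilinForm ℤ (Fin r → ℤ)} (hB : B.IsAlt) (γ : S r)
    (a : Fin r → ℕ) :
    (CentralCharge.ofTheta (selfStability B γ)).excess γ a = pairing B γ.1 a * degree γ := by
  have hself : pairing B γ.1 γ.1 = 0 := hB.self_eq_zero _
  have hdegree : CentralCharge.linearForm (fun _ => 1) γ.1 = degree γ := by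
    simp [CentralCharge.linearForm, degree]
  rw [CentralCharge.excess_apply, CentralCharge.ofTheta, hdegree, linearForm_selfStability,
    linearForm_selfStability, hself, Int.cast_zero, zero_mul, sub_zero, mul_comm]

theorem continuous_excess_ofTheta (γ : S r) (a : Fin r → ℕ) :
    Continuous fun θ : Fin r → ℝ => (CentralCharge.ofTheta θ).excess γ a := by
  simp only [CentralCharge.excess_apply, CentralCharge.ofTheta, CentralCharge.linearForm,
    AddMonoidHom.coe_mk, ZeroHom.coe_mk]
  fun_prop

theorem eventually_refinesSign {B : LinearMap.BilinForm ℤ (Fin r → ℤ)} (hB : B.IsAlt) (γ : S r) :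
    ∀ᶠ θ in 𝓝 (selfStability B γ),
      RefinesSign ((CentralCharge.ofTheta θ).excess γ) (pairing B γ.1) γ.1 := by
  have hdegree : (0 : ℝ) < degree γ := Nat.cast_pos.mpr (degree_pos γ)
  have hsign (a : Fin r → ℕ) : ∀ᶠ θ in 𝓝 (selfStability B γ),
      (0 < pairing B γ.1 a → 0 < (CentralCharge.ofTheta θ).excess γ a) ∧
        (pairing B γ.1 a < 0 → (CentralCharge.ofTheta θ).excess γ a < 0) := by
    have hlim := (continuous_excess_ofTheta γ a).tendsto (selfStability B γ)
    rw [excess_selfStability hB] at hlim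
    rw [Filter.eventually_and, Filter.eventually_imp_distrib_left,
      Filter.eventually_imp_distrib_left]
    exact ⟨fun h => hlim.eventually_const_lt (mul_pos (Int.cast_pos.mpr h) hdegree),
      fun h => hlim.eventually_lt_const (mul_neg_of_neg_of_pos (Int.cast_lt_zero.mpr h) hdegree)⟩
  filter_upwards [(Filter.eventually_all_finset (Finset.Iic γ.1)).mpr fun a _ => hsign a]
    with θ hθ a ha using hθ a (Finset.mem_Iic.mpr ha)

/-- The linear form in `θ` that vanishes if and only if the `θ`-slopes of `a` and `b` agree. -/
def wallForm (a b : S r) : (Fin r → ℝ) →ₗ[ℝ] ℝ :=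
  ∑ k, ((a.1 k : ℝ) * degree b - (b.1 k : ℝ) * degree a) • LinearMap.proj k

theorem wallForm_apply (a b : S r) (θ : Fin r → ℝ) :
    wallForm a b θ = ∑ k, ((a.1 k : ℝ) * degree b - (b.1 k : ℝ) * degree a) * θ k := by
  simp [wallForm, LinearMap.sum_apply]

theorem wallForm_eq_zero_of_slope_eq {a b : S r} {θ : Fin r → ℝ}
    (h : (CentralCharge.ofTheta θ).slope a = (CentralCharge.ofTheta θ).slope b) :
    wallForm a b θ = 0 := by
  have hne (c : S r) : (degree c : ℝ) ≠ 0 := Nat.cast_ne_zero.mpr (degree_pos c).ne'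
  have hslope (c : S r) :
      (CentralCharge.ofTheta θ).slope c = (∑ k, θ k * (c.1 k : ℝ)) / degree c := by
    simp [CentralCharge.slope, CentralCharge.ofTheta, degree]
  rw [hslope, hslope, div_eq_div_iff (hne a) (hne b), Finset.sum_mul, Finset.sum_mul,
    ← sub_eq_zero, ← Finset.sum_sub_distrib] at h
  rw [wallForm_apply, ← h]
  exact Finset.sum_congr rfl fun k _ => by ring

theorem degree_smul_eq_of_wallForm_eq_zero {a b : S r} (h : wallForm a b = 0) :
    degree b • a.1 = degree a • b.1 := by
  funext k
  have hk := wallForm_apply a b (Pi.single k 1)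
  simp only [h, LinearMap.zero_apply, Pi.single_apply, mul_ite, mul_one, mul_zero,
    Finset.sum_ite_eq', Finset.mem_univ, if_true] at hk
  rw [Pi.smul_apply, Pi.smul_apply, smul_eq_mul, smul_eq_mul, mul_comm, mul_comm (degree a)]
  exact_mod_cast (sub_eq_zero.mp hk.symm)

theorem dense_isGeneric : Dense {θ : Fin r → ℝ | (CentralCharge.ofTheta θ).IsGeneric} := by
  have hdense : Dense (⋂ p : {p : S r × S r // wallForm p.1 p.2 ≠ 0},
      ((LinearMap.ker (wallForm p.1.1 p.1.2) : Set (Fin r → ℝ))ᶜ)) := by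
    refine dense_iInter_of_isOpen
      (fun p => (Submodule.closed_of_finiteDimensional _).isOpen_compl) fun p => ?_
    rw [← interior_eq_empty_iff_dense_compl, ← Set.not_nonempty_iff_eq_empty]
    exact fun hne =>
      p.2 (LinearMap.ker_eq_top.mp (Submodule.eq_top_of_nonempty_interior' _ hne))
  refine hdense.mono fun θ hθ a b hab => ?_
  have hwall : wallForm a b = 0 := by
    by_contra hne
    exact Set.mem_iInter.mp hθ ⟨(a, b), hne⟩ (wallForm_eq_zero_of_slope_eq hab)
  exact ⟨degree b, degree a, degree_pos b, degree_pos a, degree_smul_eq_of_wallForm_eq_zero hwall⟩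

theorem genericPerturbations_neBot (B : LinearMap.BilinForm ℤ (Fin r → ℤ)) (γ : S r) :
    (genericPerturbations B γ).NeBot :=
  mem_closure_iff_nhdsWithin_neBot.mp (dense_isGeneric _)

/-! ### The attractor invariants -/

section AttractorInvariants

variable {B : LinearMap.BilinForm ℤ (Fin r → ℤ)} {R : Type*} [Ring R] [Algebra ℚ R] {σ : Type*}
  [SetLike σ R] {𝒜 : (Fin r → ℕ) → σ} [SetLike.GradedMonoid 𝒜] {A : S r → R}

theorem eventually_rationalDT_eq (hB : B.IsAlt)
    (hcomm : ∀ γ γ' : S r, B (toLattice γ.1) (toLattice γ'.1) = 0 →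
      ∀ x ∈ 𝒜 γ.1, ∀ y ∈ 𝒜 γ'.1, x * y = y * x)
    (hA : ∀ γ, A γ ∈ 𝒜 γ.1) (γ : S r) :
    ∀ᶠ θ in genericPerturbations B γ,
      (CentralCharge.ofTheta θ).rationalDT A γ = act (attractorCol B) A γ := by
  filter_upwards [nhdsWithin_le_nhds (eventually_refinesSign hB γ)] with θ hθ
  have haverage := sum_pathWeight_smul_eq (hB.self_eq_zero (toLattice γ.1))
    ((CentralCharge.ofTheta θ).excess_self γ) hθ fun a _ => a.prod_rot hB hcomm hA
  rw [← CentralCharge.act_g, CentralCharge.g_eq_excessCol, act_apply, act_apply]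
  refine (Finset.sum_congr rfl fun a _ => ?_).trans
    (haverage.symm.trans (Finset.sum_congr rfl fun a _ => ?_))
  · rw [CentralCharge.excessCol, a.2]
  · rw [attractorCol_eq_pathWeight hB, a.2]

theorem attractorDT_eq (hB : B.IsAlt)
    (hcomm : ∀ γ γ' : S r, B (toLattice γ.1) (toLattice γ'.1) = 0 →
      ∀ x ∈ 𝒜 γ.1, ∀ y ∈ 𝒜 γ'.1, x * y = y * x)
    (hA : ∀ γ, A γ ∈ 𝒜 γ.1) : attractorDT B A = act (attractorCol B) A := by
  funext γ
  have heventually := eventually_rationalDT_eq hB hcomm hA γ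
  have hex : ∃ x : R, ∀ᶠ θ in genericPerturbations B γ,
      (CentralCharge.ofTheta θ).rationalDT A γ = x := ⟨_, heventually⟩
  have := genericPerturbations_neBot B γ
  obtain ⟨θ, hact, hchoose⟩ := (heventually.and hex.choose_spec).exists
  rw [attractorDT, dif_pos hex, ← hact, hchoose]

end AttractorInvariants

end AttractorTree

theorem mainTheorem2_general {r : ℕ} (B : LinearMap.BilinForm ℤ (Fin r → ℤ))
    (hB : ∀ a b, B a b = -B b a) {R : Type*} [Ring R] [Algebra ℚ R] {σ : Type*} [SetLike σ R]
    (𝒜 : (Fin r → ℕ) → σ) [SetLike.GradedMonoid 𝒜]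
    (hcomm : ∀ γ γ' : S r, B (toLattice γ.1) (toLattice γ'.1) = 0 →
      ∀ x ∈ 𝒜 γ.1, ∀ y ∈ 𝒜 γ'.1, x * y = y * x)
    (A : S r → R) (hA : ∀ γ, A γ ∈ 𝒜 γ.1) :
    (∀ γ, (genericPerturbations B γ).NeBot ∧ ∀ᶠ θ' in genericPerturbations B γ,
      (CentralCharge.ofTheta θ').rationalDT A γ = attractorDT B A γ) ∧
    IsPlethInv (attractorCol B) (plethInv (attractorCol B)) ∧
    ∀ Z : CentralCharge r,
      IsPlethInv Z.hn (plethInv Z.hn) ∧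
      Z.rationalDT A = act (treeCol B Z) (attractorDT B A) ∧
      treeCol B Z =
        idCol r + pleth (Z.g - attractorCol B) (freeCol (idCol r - attractorCol B)) ∧
      treeCol B Z = pleth Z.g (plethInv (attractorCol B)) := by
  have hAlt : B.IsAlt := LinearMap.isAlt_iff_eq_neg_flip.mpr (LinearMap.ext₂ hB)
  have hinv := isPlethInv_plethInv (attractorCol_one B)
  have hDT := attractorDT_eq hAlt hcomm hA
  refine ⟨fun γ => ⟨genericPerturbations_neBot B γ, ?_⟩, hinv, fun Z =>
    ⟨isPlethInv_plethInv Z.hn_one, ?_, treeCol_eq_add_pleth B Z, treeCol_eq_pleth B Z⟩⟩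
  · rw [hDT]
    exact eventually_rationalDT_eq hAlt hcomm hA γ
  · rw [treeCol_eq_pleth, hDT, ← act_pleth, pleth_assoc, hinv.2, pleth_idCol, Z.act_g]

theorem mainTheorem2 {r : ℕ} (B : LinearMap.BilinForm ℤ (Fin r → ℤ))
    (hB : ∀ a b, B a b = -B b a)
    {R : Type*} [Ring R] [Algebra ℚ R] (𝒜 : (Fin r → ℕ) → Submodule ℚ R) [GradedAlgebra 𝒜]
    (hcomm : ∀ γ γ' : S r,
      B (toLattice γ.1) (toLattice γ'.1) = 0 →
        ∀ x ∈ 𝒜 γ.1, ∀ y ∈ 𝒜 γ'.1, x * y = y * x)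
    (A : S r → R) (hA : ∀ γ, A γ ∈ 𝒜 γ.1) :
    -- the attractor invariants are well defined
    (∀ γ, (genericPerturbations B γ).NeBot ∧
      ∀ᶠ θ' in genericPerturbations B γ,
        (CentralCharge.ofTheta θ').rationalDT A γ =
          attractorDT B A γ) ∧
    IsPlethInv (attractorCol B)
      (plethInv (attractorCol B)) ∧
    ∀ Z : CentralCharge r,
      IsPlethInv Z.hn (plethInv Z.hn) ∧
      -- the attractor tree formula
      Z.rationalDT A = act (treeCol B Z)
        (attractorDT B A) ∧
      treeCol B Z =
        idCol r + pleth (Z.g - attractorCol B)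
          (freeCol (idCol r - attractorCol B)) ∧
      treeCol B Z =
        pleth Z.g (plethInv (attractorCol B)) :=
  mainTheorem2_general B hB 𝒜 hcomm A hA
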